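/- **Definitions.** Let $X$ be a (real or complex) Banach space. * $X$ is *quasi-reflexive* if the image of the canonical embedding of $X$ into its bidual $X^{**}$ has finite codimension in $X^{**}$. * For an equivalent norm $|\cdot|$ on $X$ and $t\in[0,\infty)$ put $$\overline{\rho}_{|\cdot|}(t)=\sup_{|x|=1}\ \inf_{Y}\ \sup_{y\in Y,\,|y|=1}\big(|x+ty|-1\big),$$ where $Y$ runs through all closed subspaces of $X$ of finite codimension (and $\sup\emptyset=0$). For $p\in(1,\infty)$ the norm $|\cdot|$ is *$p$-asymptotically uniformly smooth* ($p$-AUS) if there is $c>0$ such that $\overline{\rho}_{|\cdot|}(t)\le c\,t^p$ for all $t\in[0,\infty)$. * For $k\in\mathbb N=\{1,2,\dots\}$ let $[\mathbb N]^k$ be the set of $k$-element subsets of $\mathbb N$, whose elements are written $\overline n=(n_1<\dots<n_k)$. The *Kalton interlaced graph* on $[\mathbb N]^k$ has an edge between $\overline n\ne\overline m$ if and only if $$n_1\le m_1\le n_2\le m_2\le\dots\le n_k\le m_k\quad\text{or}\quad m_1\le n_1\le m_2\le n_2\le\dots\le m_k\le n_k ,$$ and $d_{\mathbb K}^k$ is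 its shortest path metric. * For a map $f:M\to N$ between metric spaces and $t\in[0,\infty)$ put $\rho_f(t)=\inf\{d_N(f(x),f(y)):d_M(x,y)\ge t\}$ and $\omega_f(t)=\sup\{d_N(f(x),f(y)):d_M(x,y)\le t\}$, with $\inf\emptyset=\infty$ and $\sup\emptyset=0$. A family $(M_i)_{i\in I}$ of metric spaces *equi-coarsely embeds* into a metric space $N$ if there are functions $\rho,\omega:[0,\infty)\to[0,\infty)$ with $\lim_{t\to\infty}\rho(t)=\infty$ and maps $f_i:M_i\to N$ ($i\in I$) such that $\rho(t)\le\rho_{f_i}(t)$ and $\omega_{f_i}(t)\le\omega(t)$ for all $i\in I$ and $t\in[0,\infty)$. **Theorem.** Let $X$ be a quasi-reflexive Banach space, let $p\in(1,\infty)$ and let $q$ be its conjugate exponent, $\frac1p+\frac1q=1$. Assume that $X$ admits an equivalent $p$-AUS norm and that $X^*$ admits an equivalent $q$-AUS norm. Then the family $([\mathbb N]^k,d_{\mathbb K}^k)_{k\in\mathbb N}$ does not equi-coarsely embed into $X^{**}$. -/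

import Mathlib

set_option maxSynthPendingDepth 3

open scoped NNReal ENNReal

/-- The set `[ℕ]^k` of `k`-element subsets of `ℕ`. A subset is given by its increasing
enumeration `n₁ < n₂ < ⋯ < n_k`, that is, by a strictly increasing map `Fin k → ℕ`. -/
def KaltonVertex (k : ℕ) : Type := Fin k ↪o ℕ

namespace KaltonVertex

variable {k : ℕ}

/-- The interlacing relation `n₁ ≤ m₁ ≤ n₂ ≤ m₂ ≤ ⋯ ≤ n_k ≤ m_k`. -/
def Interlaced (n m : Fin k ↪o ℕ) : Prop :=
  (∀ i : Fin k, n i ≤ m i) ∧ ∀ i j : Fin k, (i : ℕ) + 1 = j → m i ≤ n j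

/-- Kalton's interlaced graph on `[ℕ]^k`: two distinct vertices are adjacent if and only if
one of them interlaces the other. -/
def graph (k : ℕ) : SimpleGraph (KaltonVertex k) where
  Adj n m := n ≠ m ∧ (Interlaced n m ∨ Interlaced m n)
  symm := ⟨fun _ _ h => ⟨h.1.symm, h.2.symm⟩⟩
  loopless := ⟨fun _ h => h.1 rfl⟩

theorem reachable_of_interlaced {n m : KaltonVertex k} (h : Interlaced n m) :
    (graph k).Reachable n m := by
  by_cases hnm : n = m
  · rw [hnm]
  · exact SimpleGraph.Adj.reachable (G := graph k) ⟨hnm, Or.inl h⟩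

/-- The window `(a j, a (j + 1), …, a (j + k - 1))` of a strictly increasing sequence. -/
def window (k : ℕ) (a : ℕ → ℕ) (ha : StrictMono a) (j : ℕ) : KaltonVertex k :=
  OrderEmbedding.ofStrictMono (fun i : Fin k => a (i + j))
    (fun _ _ h => ha (Nat.add_lt_add_right h j))

theorem reachable_window (a : ℕ → ℕ) (ha : StrictMono a) (j : ℕ) :
    (graph k).Reachable (window k a ha 0) (window k a ha j) := by
  induction j with
  | zero => exact SimpleGraph.Reachable.refl _
  | succ j ih =>
    refine ih.trans (reachable_of_interlaced ⟨fun i => ?_, fun i i' h => ?_⟩)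
    · exact ha.monotone (show (i : ℕ) + j ≤ i + (j + 1) by omega)
    · exact ha.monotone (show (i : ℕ) + (j + 1) ≤ i' + j by omega)

theorem reachable_shift (n : Fin k ↪o ℕ) (M : ℕ) (hM : ∀ i, n i ≤ M) :
    (graph k).Reachable n
      (window k (fun i => M + 1 + i) (fun _ _ h => Nat.add_lt_add_left h _) 0) := by
  have ha : StrictMono (fun i : ℕ => if h : i < k then n ⟨i, h⟩ else M + 1 + (i - k)) := by
    intro i j hij
    dsimp only
    split_ifs with hi hj hj
    · exact n.strictMono hij
    · have := hM ⟨i, hi⟩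
      omega
    · omega
    · omega
  have h := reachable_window (k := k) _ ha k
  have h0 : window k _ ha 0 = n := by
    refine DFunLike.ext (F := Fin k ↪o ℕ) _ _ fun i => ?_
    simp [window]
  have hk : window k _ ha k =
      window k (fun i => M + 1 + i) (fun _ _ h => Nat.add_lt_add_left h _) 0 := by
    refine DFunLike.ext (F := Fin k ↪o ℕ) _ _ fun i => ?_
    simp [window]
  rwa [h0, hk] at h

/-- The interlaced graph is connected, so the shortest path distance is a metric. -/
theorem graph_connected (k : ℕ) : (graph k).Connected := by
  have : Nonempty (KaltonVertex k) := ⟨window k id strictMono_id 0⟩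
  refine SimpleGraph.Connected.mk fun n m => ?_
  let n' : Fin k ↪o ℕ := n
  let m' : Fin k ↪o ℕ := m
  have hn : ∀ i, n' i ≤ (∑ i, n' i) + ∑ i, m' i := fun i =>
    (Finset.single_le_sum (fun _ _ => Nat.zero_le _) (Finset.mem_univ i)).trans
      (Nat.le_add_right _ _)
  have hm : ∀ i, m' i ≤ (∑ i, n' i) + ∑ i, m' i := fun i =>
    (Finset.single_le_sum (f := fun i => m' i)
      (fun _ _ => Nat.zero_le _) (Finset.mem_univ i)).trans (Nat.le_add_left _ _)
  exact (reachable_shift n' _ hn).trans (reachable_shift m' _ hm).symm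

/-- `[ℕ]^k` with the shortest path metric of the interlaced graph. -/
noncomputable instance : MetricSpace (KaltonVertex k) where
  dist n m := ((graph k).dist n m : ℝ)
  dist_self n := by simp
  dist_comm n m := by rw [SimpleGraph.dist_comm]
  dist_triangle n m l := by exact_mod_cast (graph_connected k).dist_triangle
  eq_of_dist_eq_zero h := by
    exact (graph_connected k).dist_eq_zero_iff.mp (by exact_mod_cast h)

end KaltonVertex

/-- The compression modulus `ρ_f(t) = inf {d(f x, f y) : d(x, y) ≥ t}`, with `inf ∅ = ∞`. -/
noncomputable def compressionModulus {M N : Type*} [MetricSpace M] [MetricSpace N]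
    (f : M → N) (t : ℝ≥0) : ℝ≥0∞ :=
  ⨅ (x : M) (y : M) (_ : (t : ℝ) ≤ dist x y), edist (f x) (f y)

/-- The expansion modulus `ω_f(t) = sup {d(f x, f y) : d(x, y) ≤ t}`, with `sup ∅ = 0`. -/
noncomputable def expansionModulus {M N : Type*} [MetricSpace M] [MetricSpace N]
    (f : M → N) (t : ℝ≥0) : ℝ≥0∞ :=
  ⨆ (x : M) (y : M) (_ : dist x y ≤ (t : ℝ)), edist (f x) (f y)

/-- The family of metric spaces `(M i)` equi-coarsely embeds into `N`. The finiteness of `ω`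
is part of its type. -/
def EquiCoarselyEmbeds {ι : Type*} (M : ι → Type*) [∀ i, MetricSpace (M i)]
    (N : Type*) [MetricSpace N] : Prop :=
  ∃ (ρ ω : ℝ≥0 → ℝ≥0) (f : ∀ i, M i → N),
    Filter.Tendsto ρ Filter.atTop Filter.atTop ∧
    ∀ (i : ι) (t : ℝ≥0),
      (ρ t : ℝ≥0∞) ≤ compressionModulus (f i) t ∧ expansionModulus (f i) t ≤ (ω t : ℝ≥0∞)

section Banach

variable (𝕜 : Type*) [RCLike 𝕜] (X : Type*) [NormedAddCommGroup X] [NormedSpace 𝕜 X]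

/-- The canonical image of `X` has finite codimension in the bidual of `X`. -/
def IsQuasiReflexive : Prop :=
  FiniteDimensional 𝕜 (StrongDual 𝕜 (StrongDual 𝕜 X) ⧸
    LinearMap.range (NormedSpace.inclusionInDoubleDual 𝕜 X).toLinearMap)

variable {𝕜 X}

/-- `N` is a norm on `X` that is equivalent to the given norm. -/
def IsEquivalentNorm (N : Seminorm 𝕜 X) : Prop :=
  ∃ a b : ℝ, 0 < a ∧ 0 < b ∧ ∀ x : X, a * ‖x‖ ≤ N x ∧ N x ≤ b * ‖x‖

/-- The modulus of asymptotic uniform smoothness of `X` with the (equivalent) norm `N`,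
`ρ̄(t) = sup_{N x = 1} inf_Y sup_{y ∈ Y, N y = 1} (N (x + t y) - 1)`, where `Y` runs through the
closed subspaces of finite codimension. For `t ≥ 0` the numbers `N (x + t y) - 1` are at most
`t`, and the inner suprema are nonnegative; a supremum over the empty set is `0`. -/
noncomputable def ausModulus (N : Seminorm 𝕜 X) (t : ℝ) : ℝ :=
  ⨆ x : {x : X // N x = 1},
    ⨅ Y : {Y : Submodule 𝕜 X // IsClosed (Y : Set X) ∧ FiniteDimensional 𝕜 (X ⧸ Y)},
      ⨆ y : {y : X // y ∈ Y.1 ∧ N y = 1}, (N (x.1 + (t : 𝕜) • y.1) - 1)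

/-- The norm `N` is `p`-asymptotically uniformly smooth. -/
def IsPAUS (p : ℝ) (N : Seminorm 𝕜 X) : Prop :=
  ∃ c : ℝ, 0 < c ∧ ∀ t : ℝ, 0 ≤ t → ausModulus N t ≤ c * t ^ p

variable (𝕜 X)

/-- `X` admits an equivalent `p`-asymptotically uniformly smooth norm. -/
def AdmitsEquivalentPAUSNorm (p : ℝ) : Prop :=
  ∃ N : Seminorm 𝕜 X, IsEquivalentNorm N ∧ IsPAUS p N

end Banach

/-! A coarse embedding of the interlaced graphs is in particular Lipschitz on edges, with a constant
`L` independent of `k`. Given maps `f` on `[ℕ]^k` with values in `X**` that change by at most `L`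
along edges, weak* limits along a free ultrafilter, taken in the last entries, turn `f` into a
tree `u` in `X**` whose increments are weak* null (`exists_weakStar_tree`). On a large subtree
the norm of an increment depends, up to a small error, only on its level `i`; call it `r i`. As
`X**/X` is finite dimensional, the class of `u` modulo `X` likewise depends only on the level
(`exists_isRegularSubtree`).

Smoothness is used in the additive form `IsPAUS.exists_submodule_rpow_le`. The `q`-smoothness of
`X*` yields, for two interlaced branches, a functional with norm of order `(∑ r i ^ p) ^ (1 / q)`
that separates the two values of `f` by a multiple of `∑ r i ^ p`. Hence `∑ r i ^ p` is bounded
independently of `k` (`exists_forall_sum_rpow_le`).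

For any `l`, if `k` is large, some block of `l` consecutive levels has `r i ≤ 1 / l` throughout
(`exists_block_le`). Two vertices are taken that agree before this block, such that within the block
all entries of the second exceed those of the first; their graph distance is at least `l`
(`KaltonVertex.le_dist_of_lt`). The block contributes boundedly to the difference of their images by
the triangle inequality. Above it, the differences of the two increments at each level are almost in
`X`, since the classes modulo `X` cancel, and almost weakly null, so that the `p`-smoothness of `X`
bounds their sum by a multiple of `(1 + ∑ r i ^ p) ^ (1 / p)` up to a bounded error
(`exists_extensions_norm_sub_le`). So images of points at distance at least `l` stay at bounded
distance, uniformly in `l` (`exists_dist_ge_norm_sub_le`), which contradicts `ρ → ∞`. -/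

/-! ### Asymptotic smoothness in additive form -/

section Smooth

variable {𝕜 : Type*} [RCLike 𝕜] {X : Type*} [NormedAddCommGroup X] [NormedSpace 𝕜 X]

/-- Unfolding of the modulus: a strict upper bound for `ausModulus N t` is, at each point of the
unit sphere, an upper bound along some closed subspace of finite codimension. -/
theorem exists_submodule_of_ausModulus_lt {N : Seminorm 𝕜 X} {t B : ℝ} (ht : 0 ≤ t)
    (h : ausModulus N t < B) {x : X} (hx : N x = 1) :
    ∃ Y : Submodule 𝕜 X, IsClosed (Y : Set X) ∧ FiniteDimensional 𝕜 (X ⧸ Y) ∧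
      ∀ y ∈ Y, N y = 1 → N (x + (t : 𝕜) • y) ≤ 1 + B := by
  have hnorm : ‖(t : 𝕜)‖ = t := by rw [RCLike.norm_ofReal, abs_of_nonneg ht]
  have hup : ∀ x y : X, N x = 1 → N y = 1 → N (x + (t : 𝕜) • y) - 1 ≤ t := by
    intro x y hx hy
    have := map_add_le_add N x ((t : 𝕜) • y)
    rw [map_smul_eq_mul, hnorm, hx, hy] at this
    linarith
  have hbdd : ∀ (x : X) (Y : Submodule 𝕜 X), N x = 1 →
      BddAbove (Set.range fun y : {y : X // y ∈ Y ∧ N y = 1} => N (x + (t : 𝕜) • y.1) - 1) := by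
    rintro x Y hx
    refine ⟨t, ?_⟩
    rintro _ ⟨y, rfl⟩
    exact hup x y.1 hx y.2.2
  have hsup_le : ∀ (x : X) (Y : Submodule 𝕜 X), N x = 1 →
      (⨆ y : {y : X // y ∈ Y ∧ N y = 1}, (N (x + (t : 𝕜) • y.1) - 1)) ≤ t := fun x Y hx =>
    Real.iSup_le (fun y => hup x y.1 hx y.2.2) ht
  have hle_sup : ∀ (x : X) (Y : Submodule 𝕜 X), N x = 1 →
      -1 ≤ (⨆ y : {y : X // y ∈ Y ∧ N y = 1}, (N (x + (t : 𝕜) • y.1) - 1)) := by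
    intro x Y hx
    rcases isEmpty_or_nonempty {y : X // y ∈ Y ∧ N y = 1} with he | ⟨⟨y⟩⟩
    · rw [Real.iSup_of_isEmpty]
      norm_num
    · refine le_trans ?_ (le_ciSup (hbdd x Y hx) y)
      have := apply_nonneg N (x + (t : 𝕜) • y.1)
      linarith
  have htop : IsClosed ((⊤ : Submodule 𝕜 X) : Set X) ∧ FiniteDimensional 𝕜 (X ⧸ (⊤ : Submodule 𝕜 X)) :=
    ⟨isClosed_univ, inferInstance⟩
  have hbelow : ∀ x : X, N x = 1 → BddBelow (Set.range
      fun Y : {Y : Submodule 𝕜 X // IsClosed (Y : Set X) ∧ FiniteDimensional 𝕜 (X ⧸ Y)} =>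
        ⨆ y : {y : X // y ∈ Y.1 ∧ N y = 1}, (N (x + (t : 𝕜) • y.1) - 1)) := by
    intro x hx
    refine ⟨-1, ?_⟩
    rintro _ ⟨Y, rfl⟩
    exact hle_sup x Y.1 hx
  have hx' := le_ciSup (f := fun x : {x : X // N x = 1} =>
    ⨅ Y : {Y : Submodule 𝕜 X // IsClosed (Y : Set X) ∧ FiniteDimensional 𝕜 (X ⧸ Y)},
      ⨆ y : {y : X // y ∈ Y.1 ∧ N y = 1}, (N (x.1 + (t : 𝕜) • y.1) - 1)) (by
    refine ⟨t, ?_⟩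
    rintro _ ⟨x, rfl⟩
    exact (ciInf_le (hbelow x.1 x.2) ⟨⊤, htop⟩).trans (hsup_le x.1 ⊤ x.2)) ⟨x, hx⟩
  have : Nonempty {Y : Submodule 𝕜 X // IsClosed (Y : Set X) ∧ FiniteDimensional 𝕜 (X ⧸ Y)} :=
    ⟨⟨⊤, htop⟩⟩
  obtain ⟨Y, hY⟩ := exists_lt_of_ciInf_lt (hx'.trans_lt h)
  refine ⟨Y.1, Y.2.1, Y.2.2, fun y hy hy1 => ?_⟩
  have := le_ciSup (hbdd x Y.1 hx) ⟨y, hy, hy1⟩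
  dsimp only at this hY
  linarith

/-- The power type estimate in additive form: if `N` is `p`-AUS, then `N (x + y) ^ p` exceeds
`N x ^ p` by at most a multiple of `b ^ p`, for all `y` with `N y ≤ b` in a closed subspace of
finite codimension depending on `x` and `b`. It can be iterated along a sequence of increments. -/
theorem IsPAUS.exists_submodule_rpow_le {N : Seminorm 𝕜 X} {p : ℝ} (hp : 1 < p)
    (h : IsPAUS p N) :
    ∃ C : ℝ, 0 < C ∧ ∀ (x : X) (b : ℝ), 0 ≤ b →
      ∃ Y : Submodule 𝕜 X, IsClosed (Y : Set X) ∧ FiniteDimensional 𝕜 (X ⧸ Y) ∧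
        ∀ y ∈ Y, N y ≤ b → N (x + y) ^ p ≤ N x ^ p + C * b ^ p := by
  obtain ⟨c, hc, hmod⟩ := h
  have hp0 : 0 < p := by linarith
  refine ⟨2 ^ p + (1 + 2 * c) ^ p, by positivity, fun x b hb => ?_⟩
  have hx0 : 0 ≤ N x := apply_nonneg N x
  have hbp : 0 ≤ b ^ p := Real.rpow_nonneg hb p
  have h2 : (0 : ℝ) ≤ 2 ^ p * b ^ p := by positivity
  have h3 : 0 ≤ (1 + 2 * c) ^ p * b ^ p := by positivity
  have hxp : 0 ≤ N x ^ p := Real.rpow_nonneg hx0 p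
  rcases le_or_gt (N x) b with hxb | hbx
  · refine ⟨⊤, isClosed_univ, inferInstance, fun y _ hy => ?_⟩
    have : N (x + y) ≤ 2 * b := (map_add_le_add N x y).trans (by linarith)
    have := Real.rpow_le_rpow (apply_nonneg N _) this hp0.le
    rw [Real.mul_rpow (by norm_num) hb] at this
    linarith
  rcases hb.eq_or_lt with rfl | hb0
  · refine ⟨⊤, isClosed_univ, inferInstance, fun y _ hy => ?_⟩
    have : N (x + y) ≤ N x := (map_add_le_add N x y).trans (by linarith)
    have := Real.rpow_le_rpow (apply_nonneg N _) this hp0.le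
    linarith
  have hxpos : 0 < N x := hb0.trans hbx
  set t := b / N x with ht
  have ht0 : 0 < t := div_pos hb0 hxpos
  have ht1 : t ≤ 1 := (div_le_one hxpos).2 hbx.le
  have htp : 0 < t ^ p := Real.rpow_pos_of_pos ht0 p
  have htp1 : t ^ p ≤ 1 := Real.rpow_le_one ht0.le ht1 hp0.le
  have hN : ∀ (r : ℝ) (v : X), 0 ≤ r → N ((r : 𝕜) • v) = r * N v := fun r v hr => by
    rw [map_smul_eq_mul, RCLike.norm_ofReal, abs_of_nonneg hr]
  obtain ⟨Y, hYc, hYf, hY⟩ := exists_submodule_of_ausModulus_lt (N := N) (B := 2 * c * t ^ p)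
    ht0.le ((hmod t ht0.le).trans_lt (by nlinarith [mul_pos hc htp]))
    (x := (((N x)⁻¹ : ℝ) : 𝕜) • x) (by rw [hN _ _ (by positivity)]; field_simp)
  refine ⟨Y, hYc, hYf, fun y hy hyb => ?_⟩
  have hy0 : 0 ≤ N y := apply_nonneg N y
  have key : N (x + y) ≤ N x * (1 + 2 * c * t ^ p) := by
    rcases hy0.eq_or_lt with hy0 | hypos
    · have := map_add_le_add N x y
      nlinarith [mul_pos hc htp, mul_pos hxpos (mul_pos hc htp)]
    -- `x + y` is a convex combination of `x` and of the translate of `x` by the multiple of `y`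
    -- of norm exactly `b`.
    set θ := N y / b with hθ
    have hθ0 : 0 ≤ θ := by positivity
    have hθ1 : θ ≤ 1 := (div_le_one hb0).2 hyb
    have h1 := hY ((((N y)⁻¹ : ℝ) : 𝕜) • y) (Y.smul_mem _ hy)
      (by rw [hN _ _ (by positivity)]; field_simp)
    have hdec : x + y = ((1 - θ : ℝ) : 𝕜) • x + ((θ * N x : ℝ) : 𝕜) •
        ((((N x)⁻¹ : ℝ) : 𝕜) • x + (t : 𝕜) • ((((N y)⁻¹ : ℝ) : 𝕜) • y)) := by
      rw [smul_add, smul_smul, smul_smul, smul_smul, ← add_assoc, ← add_smul, ← RCLike.ofReal_mul,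
        ← RCLike.ofReal_mul, ← RCLike.ofReal_mul, ← RCLike.ofReal_add]
      have e1 : 1 - θ + θ * N x * (N x)⁻¹ = 1 := by field_simp; ring
      have e2 : θ * N x * t * (N y)⁻¹ = 1 := by rw [hθ, ht]; field_simp
      rw [e1, e2]
      simp
    have h4 := map_add_le_add N (((1 - θ : ℝ) : 𝕜) • x) (((θ * N x : ℝ) : 𝕜) •
        ((((N x)⁻¹ : ℝ) : 𝕜) • x + (t : 𝕜) • ((((N y)⁻¹ : ℝ) : 𝕜) • y)))
    rw [← hdec, hN _ _ (by linarith), hN _ _ (by positivity)] at h4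
    have h5 : θ * N x * N ((((N x)⁻¹ : ℝ) : 𝕜) • x + (t : 𝕜) • ((((N y)⁻¹ : ℝ) : 𝕜) • y)) ≤
      θ * N x * (1 + 2 * c * t ^ p) := by gcongr
    have h6 : θ * (N x * (2 * c * t ^ p)) ≤ 1 * (N x * (2 * c * t ^ p)) := by gcongr
    nlinarith
  have hconv : (1 + 2 * c * t ^ p) ^ p ≤ 1 + (1 + 2 * c) ^ p * t ^ p := by
    have h1 : (1 : ℝ) ∈ Set.Ici 0 := by simp
    have h2 : 1 + 2 * c ∈ Set.Ici (0 : ℝ) := by simp only [Set.mem_Ici]; positivity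
    have := (convexOn_rpow hp.le).2 h1 h2 (sub_nonneg.2 htp1) htp.le (sub_add_cancel 1 (t ^ p))
    simp only [smul_eq_mul, Real.one_rpow] at this
    have e : (1 - t ^ p) * 1 + t ^ p * (1 + 2 * c) = 1 + 2 * c * t ^ p := by ring
    rw [e] at this
    linarith
  have h7 := Real.rpow_le_rpow (apply_nonneg N _) key hp0.le
  rw [Real.mul_rpow hx0 (by positivity)] at h7
  have h8 : N x ^ p * (1 + 2 * c * t ^ p) ^ p ≤ N x ^ p * (1 + (1 + 2 * c) ^ p * t ^ p) := by
    gcongr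
  have h9 : N x ^ p * t ^ p = b ^ p := by
    rw [← Real.mul_rpow hx0 ht0.le, ht]
    congr 1
    field_simp
  calc N (x + y) ^ p ≤ N x ^ p + (1 + 2 * c) ^ p * (N x ^ p * t ^ p) := by linarith
    _ ≤ _ := by rw [h9]; linarith

end Smooth

/-! ### Ultrafilter limits along trees -/

section Trees

open Filter Topology

/-- The ultrafilter of the `r`-fold extensions of the node `s`: a property holds along it when it
holds for `U`-many `n₁`, `U`-many `n₂`, …, `U`-many `n_r` at the node `n_r :: ⋯ :: n₁ :: s`.
Nodes are lists written in reverse, so that a child of `s` is `n :: s`. -/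
noncomputable def extensions (U : Ultrafilter ℕ) : ℕ → List ℕ → Ultrafilter (List ℕ)
  | 0, s => pure s
  | r + 1, s => U.bind fun n => extensions U r (n :: s)

variable {U : Ultrafilter ℕ}

theorem eventually_extensions_zero {s : List ℕ} {P : List ℕ → Prop} :
    (∀ᶠ t in (extensions U 0 s : Filter (List ℕ)), P t) ↔ P s := Iff.rfl

theorem eventually_extensions_succ {r : ℕ} {s : List ℕ} {P : List ℕ → Prop} :
    (∀ᶠ t in (extensions U (r + 1) s : Filter (List ℕ)), P t) ↔
      ∀ᶠ n in (U : Filter ℕ), ∀ᶠ t in (extensions U r (n :: s) : Filter (List ℕ)), P t := Iff.rfl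

theorem eventually_extensions_suffix (r : ℕ) (s : List ℕ) :
    ∀ᶠ t in (extensions U r s : Filter (List ℕ)), s <:+ t ∧ t.length = s.length + r := by
  induction r generalizing s with
  | zero => exact eventually_extensions_zero.2 ⟨List.suffix_rfl, rfl⟩
  | succ r ih =>
    refine eventually_extensions_succ.2 (Eventually.of_forall fun n => ?_)
    filter_upwards [ih (n :: s)] with t ht
    refine ⟨(List.suffix_cons n s).trans ht.1, ?_⟩
    rw [ht.2, List.length_cons]
    omega

theorem eventually_forall_mem_lt (hU : (U : Filter ℕ) ≤ atTop) (s : List ℕ) (T : ℕ) :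
    ∀ᶠ n in (U : Filter ℕ), T < n ∧ ∀ x ∈ s, x < n := by
  filter_upwards [hU (eventually_gt_atTop T), hU (eventually_gt_atTop s.sum)] with n h1 h2
  exact ⟨h1, fun x hx => (List.le_sum_of_mem hx).trans_lt h2⟩

theorem eventually_extensions_pairwise (hU : (U : Filter ℕ) ≤ atTop) (T r : ℕ) (s : List ℕ)
    (hs : s.Pairwise (· > ·)) (hT : ∀ x ∈ s, T ≤ x) :
    ∀ᶠ t in (extensions U r s : Filter (List ℕ)), t.Pairwise (· > ·) ∧ ∀ x ∈ t, T ≤ x := by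
  induction r generalizing s with
  | zero => exact eventually_extensions_zero.2 ⟨hs, hT⟩
  | succ r ih =>
    refine eventually_extensions_succ.2 ?_
    filter_upwards [eventually_forall_mem_lt hU s T] with n hn
    refine ih (n :: s) (List.pairwise_cons.2 ⟨hn.2, hs⟩) fun x hx => ?_
    rcases List.mem_cons.1 hx with rfl | hx
    · exact hn.1.le
    · exact hT x hx

/-- A limit along the extensions of `s` is an iterated limit. -/
theorem tendsto_of_tendsto_extensions {Y : Type*} [TopologicalSpace Y] [RegularSpace Y]
    {r : ℕ} {s : List ℕ} {g : List ℕ → Y} {h : ℕ → Y} {c : Y}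
    (hc : Tendsto g (extensions U (r + 1) s : Filter (List ℕ)) (𝓝 c))
    (hh : ∀ n, Tendsto g (extensions U r (n :: s) : Filter (List ℕ)) (𝓝 (h n))) :
    Tendsto h U (𝓝 c) := by
  refine (closed_nhds_basis c).tendsto_right_iff.2 fun C hC => ?_
  filter_upwards [eventually_extensions_succ.1 (hc.eventually hC.1)] with n hn
  exact hC.2.mem_of_tendsto (hh n) hn

variable {𝕜 : Type*} [RCLike 𝕜] {W : Type*} [NormedAddCommGroup W] [NormedSpace 𝕜 W]

/-- Bounded families of functionals have weak* limits along ultrafilters (Banach–Alaoglu). -/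
theorem exists_weakStar_limit {ι : Type*} (V : Ultrafilter ι) (f : ι → StrongDual 𝕜 W) {B : ℝ}
    (hf : ∀ i, ‖f i‖ ≤ B) :
    ∃ u : StrongDual 𝕜 W, ‖u‖ ≤ B ∧ ∀ φ, Tendsto (fun i => f i φ) V (𝓝 (u φ)) := by
  obtain ⟨u, hu, hlim⟩ := (WeakDual.isCompact_closedBall (𝕜 := 𝕜) (E := W) 0 B).ultrafilter_le_nhds'
    (V.map fun i => StrongDual.toWeakDual (f i)) (by
      refine Filter.mem_map.2 (Filter.univ_mem' fun i => ?_)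
      simpa using hf i)
  refine ⟨WeakDual.toStrongDual u, by simpa using hu, fun φ => ?_⟩
  exact ((WeakDual.eval_continuous φ).tendsto u).comp hlim

/-- A bounded map on the nodes of length `k` extends to a martingale-like tree: the value at a
node is the weak* limit along `U` of the values at its children. -/
theorem exists_weakStar_tree (U : Ultrafilter ℕ) (k : ℕ) (f : List ℕ → StrongDual 𝕜 W) {B : ℝ}
    (hf : ∀ t, ‖f t‖ ≤ B) :
    ∃ u : List ℕ → StrongDual 𝕜 W, (∀ s, ‖u s‖ ≤ B) ∧ (∀ s, s.length = k → u s = f s) ∧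
      ∀ s, s.length < k → ∀ φ, Tendsto (fun n => u (n :: s) φ) U (𝓝 (u s φ)) := by
  choose u hB hu using fun s : List ℕ =>
    exists_weakStar_limit (extensions U (k - s.length) s) f hf
  refine ⟨u, hB, fun s hs => ?_, fun s hs φ => ?_⟩
  · ext φ
    have h := hu s φ
    rw [hs, Nat.sub_self] at h
    exact tendsto_nhds_unique h (tendsto_pure_nhds (fun t => f t φ) s)
  · have hk : k - s.length = (k - (s.length + 1)) + 1 := by omega
    have h := hu s φ
    rw [hk] at h
    refine tendsto_of_tendsto_extensions h fun n => ?_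
    have h' := hu (n :: s) φ
    rwa [List.length_cons] at h'

/-- `G` is a subtree of nodes of length at most `k`, with `U`-many children at each node, along
which the norms of the increments of `u` and the images of `u` under `π` depend only on the
length of the node, up to `δ`. Its nodes of full length enumerate `k`-element subsets of
`{k, k + 1, …}`. -/
structure IsRegularSubtree {F : Type*} [NormedAddCommGroup F] [NormedSpace 𝕜 F]
    (U : Ultrafilter ℕ) (k : ℕ) (u : List ℕ → StrongDual 𝕜 W) (π : StrongDual 𝕜 W →L[𝕜] F)
    (r : ℕ → ℝ) (α : ℕ → F) (δ : ℝ) (G : List ℕ → Prop) : Prop where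
  nil : G []
  cons : ∀ s, G s → s.length < k → ∀ᶠ n in (U : Filter ℕ), G (n :: s)
  pairwise : ∀ t, G t → t.length = k → t.Pairwise (· > ·) ∧ ∀ x ∈ t, k ≤ x
  norm_sub : ∀ n s, G (n :: s) → s.length < k → |‖u (n :: s) - u s‖ - r s.length| ≤ δ
  quot : ∀ s, G s → ‖π (u s) - α s.length‖ ≤ δ

/-- The limits over all levels of the increments and of the images under `π` exist by compactness,
and almost every full node, hence a whole subtree, is close to them. -/
theorem exists_isRegularSubtree {F : Type*} [NormedAddCommGroup F] [NormedSpace 𝕜 F]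
    [FiniteDimensional 𝕜 F] (hU : (U : Filter ℕ) ≤ atTop) (k : ℕ) (u : List ℕ → StrongDual 𝕜 W)
    {B : ℝ} (hB : ∀ s, ‖u s‖ ≤ B) (π : StrongDual 𝕜 W →L[𝕜] F) :
    ∃ (r : ℕ → ℝ) (α : ℕ → F), (∀ i, 0 ≤ r i) ∧
      ∀ δ > 0, ∃ G, IsRegularSubtree U k u π r α δ G := by
  have : ProperSpace F := FiniteDimensional.proper_rclike 𝕜 F
  set V := extensions U k [] with hV
  have hr : ∀ i, ∃ c ∈ Set.Icc 0 (B + B),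
      Tendsto (fun t : List ℕ => ‖u (t.drop (k - (i + 1))) - u (t.drop (k - i))‖) V (𝓝 c) :=
    fun i => isCompact_Icc.ultrafilter_le_nhds' (V.map _)
      (Filter.mem_map.2 (Filter.univ_mem' fun t =>
        ⟨norm_nonneg _, (norm_sub_le _ _).trans (add_le_add (hB _) (hB _))⟩))
  have hα : ∀ i, ∃ c ∈ Metric.closedBall (0 : F) (‖π‖ * B),
      Tendsto (fun t : List ℕ => π (u (t.drop (k - i)))) V (𝓝 c) := fun i =>
    (isCompact_closedBall (0 : F) (‖π‖ * B)).ultrafilter_le_nhds' (V.map _)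
      (Filter.mem_map.2 (Filter.univ_mem' fun t => by
        refine mem_closedBall_zero_iff.2 ((π.le_opNorm _).trans ?_)
        exact mul_le_mul_of_nonneg_left (hB _) (norm_nonneg _)))
  choose r hr0 hr using hr
  choose α _ hα using hα
  refine ⟨r, α, fun i => (hr0 i).1, fun δ hδ => ?_⟩
  let A : List ℕ → Prop := fun t => (t.Pairwise (· > ·) ∧ ∀ x ∈ t, k ≤ x) ∧
    ∀ i ∈ Set.Iic k, |‖u (t.drop (k - (i + 1))) - u (t.drop (k - i))‖ - r i| ≤ δ ∧
      ‖π (u (t.drop (k - i))) - α i‖ ≤ δ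
  have hA : ∀ᶠ t in (V : Filter (List ℕ)), A t := by
    refine (eventually_extensions_pairwise hU k k [] List.Pairwise.nil (by simp)).and
      ((Filter.eventually_all_finite (Set.finite_Iic k)).2 fun i _ => ?_)
    filter_upwards [(hr i).eventually (Metric.closedBall_mem_nhds _ hδ),
      (hα i).eventually (Metric.closedBall_mem_nhds _ hδ)] with t h1 h2
    exact ⟨by simpa [Real.dist_eq] using h1, by simpa [dist_eq_norm] using h2⟩
  let G : List ℕ → Prop := fun s =>
    s.length ≤ k ∧ ∀ᶠ t in (extensions U (k - s.length) s : Filter (List ℕ)), A t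
  have hG : ∀ s, G s → ∃ t, A t ∧ s <:+ t ∧ t.length = k := by
    rintro s ⟨h1, h2⟩
    obtain ⟨t, ht, hs, hl⟩ := (h2.and (eventually_extensions_suffix _ _)).exists
    exact ⟨t, ht, hs, by omega⟩
  have hdrop : ∀ s t : List ℕ, s <:+ t → t.length = k → t.drop (k - s.length) = s := by
    rintro s t h1 h2
    rw [← h2]
    exact (List.suffix_iff_eq_drop.1 h1).symm
  refine ⟨G, ⟨Nat.zero_le k, hA⟩, ?_, ?_, ?_, ?_⟩
  · rintro s ⟨-, h⟩ hs
    rw [show k - s.length = (k - (s.length + 1)) + 1 by omega] at h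
    filter_upwards [eventually_extensions_succ.1 h] with n hn
    exact ⟨hs, hn⟩
  · rintro t ht hk
    obtain ⟨t', h1, h2, h3⟩ := hG t ht
    rw [h2.eq_of_length (hk.trans h3.symm)]
    exact h1.1
  · rintro n s hs hk
    obtain ⟨t, h1, h2, h3⟩ := hG _ hs
    have h4 := (h1.2 s.length hk.le).1
    rw [hdrop s t ((List.suffix_cons n s).trans h2) h3] at h4
    have h5 := hdrop _ t h2 h3
    rw [List.length_cons] at h5
    rwa [h5] at h4
  · rintro s hs
    obtain ⟨t, h1, h2, h3⟩ := hG _ hs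
    have h4 := (h1.2 s.length hs.1).2
    rwa [hdrop s t h2 h3] at h4

end Trees

/-! ### Weak* null families and subspaces of finite codimension -/

section WeakStarNull

open Filter Topology

variable {𝕜 : Type*} [RCLike 𝕜] {W : Type*} [NormedAddCommGroup W] [NormedSpace 𝕜 W]

/-- A weak* null family of functionals almost attains a fixed proportion of its norms on any closed
subspace of finite codimension. -/
theorem eventually_exists_mem_le_re {ι : Type*} {l : Filter ι} {z : ι → StrongDual 𝕜 W}
    (hz : ∀ φ, Tendsto (fun i => z i φ) l (𝓝 0)) (Y : Submodule 𝕜 W) (hY : IsClosed (Y : Set W))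
    [FiniteDimensional 𝕜 (W ⧸ Y)] {δ : ℝ} (hδ : 0 < δ) :
    ∀ᶠ i in l, ∃ y ∈ Y, ‖y‖ ≤ 1 ∧ ‖z i‖ / 4 - δ ≤ RCLike.re (z i y) := by
  have : ProperSpace (W ⧸ Y) := FiniteDimensional.proper_rclike 𝕜 (W ⧸ Y)
  -- The functionals are small on lifts of a finite net of the unit ball of `W ⧸ Y`.
  obtain ⟨S, hS1, hSf, hS⟩ := Metric.finite_approx_of_totallyBounded
    (isCompact_closedBall (0 : W ⧸ Y) 1).totallyBounded (1 / 20) (by norm_num)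
  choose lift hlift hliftn using fun c : W ⧸ Y =>
    Submodule.Quotient.norm_mk_lt c (show (0 : ℝ) < 1 by norm_num)
  have hev : ∀ᶠ i in l, ∀ c ∈ S, ‖z i (lift c)‖ < δ := by
    refine (eventually_all_finite hSf).2 fun c _ => ?_
    have := (hz (lift c)).norm
    rw [norm_zero] at this
    exact this.eventually (gt_mem_nhds hδ)
  filter_upwards [hev] with i hi
  rcases (norm_nonneg (z i)).eq_or_lt with h0 | hpos
  · refine ⟨0, Y.zero_mem, by simp, ?_⟩
    rw [← h0]
    simp [hδ.le]
  obtain ⟨w, hw, hzw⟩ := (z i).exists_lt_apply_of_lt_opNorm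
    (show (9 / 10) * ‖z i‖ < ‖z i‖ by linarith)
  have hmk : ‖(Submodule.Quotient.mk w : W ⧸ Y)‖ ≤ 1 :=
    (Submodule.Quotient.norm_mk_le Y w).trans hw.le
  have hmem := hS (mem_closedBall_zero_iff.2 hmk)
  simp only [Set.mem_iUnion, Metric.mem_ball, dist_eq_norm] at hmem
  obtain ⟨c, hc, hwc⟩ := hmem
  obtain ⟨e, he, hen⟩ := Submodule.Quotient.norm_mk_lt
    ((Submodule.Quotient.mk w : W ⧸ Y) - c) (show (0 : ℝ) < 1 / 20 by norm_num)
  set y := w - lift c - e with hy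
  have hyY : y ∈ Y := by
    rw [← Submodule.Quotient.mk_eq_zero, hy, Submodule.Quotient.mk_sub, Submodule.Quotient.mk_sub,
      hlift, he, sub_self]
  have hyn : ‖y‖ ≤ 16 / 5 := by
    have h1 := norm_sub_le (w - lift c) e
    have h2 := norm_sub_le w (lift c)
    have h3 := hliftn c
    have h4 : ‖c‖ ≤ 1 := mem_closedBall_zero_iff.1 (hS1 hc)
    rw [← hy] at h1
    linarith
  have hzy : 4 / 5 * ‖z i‖ - δ ≤ ‖z i y‖ := by
    have h1 : z i w = z i y + z i (lift c) + z i e := by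
      rw [hy, map_sub, map_sub]
      ring
    have h2 := norm_add₃_le (a := z i y) (b := z i (lift c)) (c := z i e)
    rw [← h1] at h2
    have h3 := hi c hc
    have h4 : ‖z i e‖ ≤ ‖z i‖ * (1 / 10) :=
      ((z i).le_opNorm e).trans (mul_le_mul_of_nonneg_left (by linarith) hpos.le)
    linarith
  obtain ⟨a, ha, hav⟩ := RCLike.exists_norm_eq_mul_self (z i y)
  refine ⟨((5 / 16 : ℝ) : 𝕜) • a • y, Y.smul_mem _ (Y.smul_mem _ hyY), ?_, ?_⟩
  · rw [norm_smul, norm_smul, ha, RCLike.norm_ofReal, abs_of_pos (by norm_num)]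
    linarith
  · rw [map_smul (z i), map_smul (z i), smul_eq_mul, smul_eq_mul, ← hav, ← RCLike.ofReal_mul, RCLike.ofReal_re]
    linarith

theorem norm_comp_mkQL_le {X : Type*} [NormedAddCommGroup X] [NormedSpace 𝕜 X]
    (Y : Submodule 𝕜 X) [IsClosed (Y : Set X)] (ψ : StrongDual 𝕜 (X ⧸ Y)) :
    ‖ψ.comp Y.mkQL‖ ≤ ‖ψ‖ := by
  refine ContinuousLinearMap.opNorm_le_bound _ (norm_nonneg _) fun x => ?_
  exact (ψ.le_opNorm _).trans
    (mul_le_mul_of_nonneg_left (Submodule.Quotient.norm_mk_le Y x) (norm_nonneg _))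

/-- A bounded weak* null family is uniformly small on the unit ball of the annihilator of a
subspace of finite codimension, here given as the set of functionals that factor through the
quotient. -/
theorem eventually_forall_dual_quotient_le {X : Type*} [NormedAddCommGroup X] [NormedSpace 𝕜 X]
    {ι : Type*} {l : Filter ι} {z : ι → StrongDual 𝕜 (StrongDual 𝕜 X)} {B : ℝ}
    (hB : ∀ i, ‖z i‖ ≤ B) (hz : ∀ φ, Tendsto (fun i => z i φ) l (𝓝 0)) (Y : Submodule 𝕜 X)
    [IsClosed (Y : Set X)] [FiniteDimensional 𝕜 (X ⧸ Y)] {δ : ℝ} (hδ : 0 < δ) :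
    ∀ᶠ i in l, ∀ ψ : StrongDual 𝕜 (X ⧸ Y), ‖z i (ψ.comp Y.mkQL)‖ ≤ δ * ‖ψ‖ := by
  have : ProperSpace (StrongDual 𝕜 (X ⧸ Y)) := FiniteDimensional.proper_rclike 𝕜 _
  obtain ⟨S, -, hSf, hS⟩ := Metric.finite_approx_of_totallyBounded
    (isCompact_closedBall (0 : StrongDual 𝕜 (X ⧸ Y)) 1).totallyBounded (δ / (2 * (|B| + 1)))
    (by positivity)
  have hq : ∀ ψ : StrongDual 𝕜 (X ⧸ Y), ‖ψ.comp Y.mkQL‖ ≤ ‖ψ‖ := fun ψ =>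
    norm_comp_mkQL_le Y ψ
  have hev : ∀ᶠ i in l, ∀ c ∈ S, ‖z i (c.comp Y.mkQL)‖ < δ / 2 := by
    refine (eventually_all_finite hSf).2 fun c _ => ?_
    have := (hz (c.comp Y.mkQL)).norm
    rw [norm_zero] at this
    exact this.eventually (gt_mem_nhds (half_pos hδ))
  filter_upwards [hev] with i hi
  have hball : ∀ ψ : StrongDual 𝕜 (X ⧸ Y), ‖ψ‖ ≤ 1 → ‖z i (ψ.comp Y.mkQL)‖ ≤ δ := by
    intro ψ hψ
    have hmem := hS (mem_closedBall_zero_iff.2 hψ)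
    simp only [Set.mem_iUnion, Metric.mem_ball, dist_eq_norm] at hmem
    obtain ⟨c, hc, hψc⟩ := hmem
    have h1 : ψ.comp Y.mkQL = (ψ - c).comp Y.mkQL + c.comp Y.mkQL := by
      rw [← ContinuousLinearMap.add_comp, sub_add_cancel]
    have h2 : ‖z i ((ψ - c).comp Y.mkQL)‖ ≤ (|B| + 1) * (δ / (2 * (|B| + 1))) := by
      refine ((z i).le_opNorm _).trans ?_
      gcongr
      · linarith [hB i, le_abs_self B]
      · exact (hq _).trans hψc.le
    have h3 : (|B| + 1) * (δ / (2 * (|B| + 1))) = δ / 2 := by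
      have : |B| + 1 ≠ 0 := by positivity
      field_simp
    rw [h1, map_add]
    refine (norm_add_le _ _).trans ?_
    linarith [hi c hc]
  -- Homogeneity reduces the claim to the unit ball.
  intro ψ
  rcases eq_or_ne ψ 0 with rfl | hψ
  · simp
  have hψ0 : 0 < ‖ψ‖ := norm_pos_iff.2 hψ
  have h := hball (((‖ψ‖⁻¹ : ℝ) : 𝕜) • ψ) (by
    rw [norm_smul, RCLike.norm_ofReal, abs_of_pos (inv_pos.2 hψ0), inv_mul_cancel₀ hψ0.ne'])
  rw [ContinuousLinearMap.smul_comp, map_smul, norm_smul, RCLike.norm_ofReal,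
    abs_of_pos (inv_pos.2 hψ0)] at h
  rwa [inv_mul_le_iff₀ hψ0, mul_comm] at h

/-- An element of the bidual that is close to `X` and almost vanishes on the annihilator of `Y` is
close to `Y`. -/
theorem exists_mem_norm_sub_le {X : Type*} [NormedAddCommGroup X] [NormedSpace 𝕜 X]
    (Y : Submodule 𝕜 X) [IsClosed (Y : Set X)] {d : StrongDual 𝕜 (StrongDual 𝕜 X)} {x : X}
    {η δ : ℝ} (hδ : 0 < δ) (hη : 0 ≤ η)
    (hx : ‖d - NormedSpace.inclusionInDoubleDual 𝕜 X x‖ ≤ η)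
    (hd : ∀ ψ : StrongDual 𝕜 (X ⧸ Y), ‖d (ψ.comp Y.mkQL)‖ ≤ δ * ‖ψ‖) :
    ∃ y ∈ Y, ‖d - NormedSpace.inclusionInDoubleDual 𝕜 X y‖ ≤ 2 * η + 2 * δ := by
  set J := NormedSpace.inclusionInDoubleDual 𝕜 X with hJ
  have hJn : ∀ v : X, ‖J v‖ = ‖v‖ := (NormedSpace.inclusionInDoubleDualLi 𝕜 (E := X)).norm_map
  have hq : ‖(Submodule.Quotient.mk x : X ⧸ Y)‖ ≤ η + δ := by
    refine NormedSpace.norm_le_dual_bound 𝕜 _ (by positivity) fun ψ => ?_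
    have h1 : ψ (Submodule.Quotient.mk x) =
        d (ψ.comp Y.mkQL) - (d - J x) (ψ.comp Y.mkQL) := by
      rw [_root_.sub_apply, sub_sub_cancel]
      rfl
    have h2 : ‖(d - J x) (ψ.comp Y.mkQL)‖ ≤ η * ‖ψ‖ := by
      refine ((d - J x).le_opNorm _).trans ?_
      gcongr
      exact norm_comp_mkQL_le Y ψ
    rw [h1]
    refine (norm_sub_le _ _).trans ?_
    linarith [hd ψ]
  obtain ⟨e, he, hen⟩ := Submodule.Quotient.norm_mk_lt (Submodule.Quotient.mk x : X ⧸ Y) hδ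
  refine ⟨x - e, ?_, ?_⟩
  · rw [← Submodule.Quotient.mk_eq_zero, Submodule.Quotient.mk_sub, he, sub_self]
  · have h3 : d - J (x - e) = (d - J x) + J e := by
      rw [map_sub]
      abel
    rw [h3]
    refine (norm_add_le _ _).trans ?_
    rw [hJn]
    linarith

end WeakStarNull

/-! ### Increments along interlaced branches -/

section Lower

open Filter Topology

/-- The interlacing relation for nodes, that is, for reversed lists. -/
def NodesInterlaced : List ℕ → List ℕ → Prop
  | [], [] => True
  | n :: s, m :: s' => n ≤ m ∧ (∀ x ∈ s', x ≤ n) ∧ NodesInterlaced s s'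
  | _, _ => False

variable {𝕜 : Type*} [RCLike 𝕜] {W : Type*} [NormedAddCommGroup W] [NormedSpace 𝕜 W]

/-- The lower estimate. Two interlaced branches through a regular subtree are built together with
a vector `ψ` on which the difference of the values of `u` is at least the sum of the sizes of the
increments with the weights `τ`. At each level the new summand of `ψ` is taken in a subspace of
finite codimension, so that smoothness controls `M ψ`; it is annihilated by the earlier increments,
and the later ones are weak* small on it. -/
theorem exists_interlaced_functional {U : Ultrafilter ℕ} (hU : (U : Filter ℕ) ≤ atTop)
    {M : Seminorm 𝕜 W} {q C b : ℝ} (hb : 0 ≤ b) (hMb : ∀ w, M w ≤ b * ‖w‖)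
    (hC : ∀ (x : W) (c : ℝ), 0 ≤ c → ∃ Y : Submodule 𝕜 W, IsClosed (Y : Set W) ∧
      FiniteDimensional 𝕜 (W ⧸ Y) ∧ ∀ y ∈ Y, M y ≤ c → M (x + y) ^ q ≤ M x ^ q + C * c ^ q)
    {k : ℕ} {u : List ℕ → StrongDual 𝕜 W}
    (hu : ∀ s, s.length < k → ∀ φ, Tendsto (fun n => u (n :: s) φ) U (𝓝 (u s φ)))
    {r : ℕ → ℝ} {δ : ℝ} (hδ : 0 < δ) {G : List ℕ → Prop}
    (hG : ∀ s, G s → s.length < k → ∀ᶠ n in (U : Filter ℕ), G (n :: s))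
    (hr : ∀ n s, G (n :: s) → s.length < k → |‖u (n :: s) - u s‖ - r s.length| ≤ δ)
    {τ : ℕ → ℝ} (hτ : ∀ i, 0 ≤ τ i) (m : ℕ) :
    ∀ (s s' : List ℕ) (φ : W), s.length + m = k → s'.length = s.length → G s → G s' →
      NodesInterlaced s s' →
      ∃ (t t' : List ℕ) (ψ : W), t.length = k ∧ t'.length = k ∧ G t ∧ G t' ∧
        NodesInterlaced t t' ∧
        M ψ ^ q ≤ M φ ^ q + ∑ i ∈ Finset.Ico s.length k, C * (b * τ i) ^ q ∧
        RCLike.re ((u s - u s') φ) +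
            ∑ i ∈ Finset.Ico s.length k, (τ i * (r i / 4 - 2 * δ) - 2 * δ) ≤
          RCLike.re ((u t - u t') ψ) := by
  induction m with
  | zero =>
    intro s s' φ hs hs' hGs hGs' hI
    refine ⟨s, s', φ, hs, hs'.trans hs, hGs, hGs', hI, ?_, ?_⟩ <;>
    · rw [show s.length = k from hs]
      simp
  | succ m ih =>
    intro s s' φ hs hs' hGs hGs' hI
    have hsk : s.length < k := by omega
    have hs'k : s'.length < k := by omega
    have hnull : ∀ s : List ℕ, s.length < k → ∀ φ,
        Tendsto (fun n => (u (n :: s) - u s) φ) U (𝓝 0) := by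
      intro s hs φ
      have := (hu s hs φ).sub_const (u s φ)
      rwa [sub_self] at this
    have hsmall : ∀ s : List ℕ, s.length < k → ∀ φ,
        ∀ᶠ n in (U : Filter ℕ), |RCLike.re ((u (n :: s) - u s) φ)| ≤ δ := by
      intro s hs φ
      have := (hnull s hs φ).norm
      rw [norm_zero] at this
      filter_upwards [this.eventually (ge_mem_nhds hδ)] with n hn
      exact (RCLike.abs_re_le_norm _).trans hn
    obtain ⟨Y, hYc, hYf, hY⟩ := hC φ (b * τ s.length) (mul_nonneg hb (hτ _))
    obtain ⟨n, hn1, hn2, hn3⟩ := ((hG s hGs hsk).and ((hsmall s hsk φ).and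
      (eventually_forall_mem_lt hU s' 0))).exists
    -- The functional `y` below kills both the old difference and the new increment at `s`.
    let Y' : Submodule 𝕜 W := Y ⊓ ((u s - u s').toLinearMap.ker ⊓ (u (n :: s) - u s).toLinearMap.ker)
    have hY'c : IsClosed (Y' : Set W) :=
      hYc.inter ((u s - u s').isClosed_ker.inter (u (n :: s) - u s).isClosed_ker)
    have hY'f : FiniteDimensional 𝕜 (W ⧸ Y') := by
      have h1 : Y.CoFG := hYf
      exact h1.inf (Submodule.CoFG.inf (Submodule.CoFG.ker _) (Submodule.CoFG.ker _))
    obtain ⟨m', hm1, hm2, hm3, y, hy, hy1, hzy⟩ := ((hG s' hGs' hs'k).and ((hsmall s' hs'k φ).and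
      ((eventually_forall_mem_lt hU [] n).and
        (eventually_exists_mem_le_re (hnull s' hs'k) Y' hY'c hδ)))).exists
    set v : W := -((τ s.length : 𝕜) • y) with hv
    have hvY : v ∈ Y' := Y'.neg_mem (Y'.smul_mem _ hy)
    have hv1 : (u s - u s') v = 0 := hvY.2.1
    have hv2 : (u (n :: s) - u s) v = 0 := hvY.2.2
    have hMv : M v ≤ b * τ s.length := by
      rw [hv, map_neg_eq_map, map_smul_eq_mul, RCLike.norm_ofReal, abs_of_nonneg (hτ _)]
      have := (hMb y).trans (mul_le_mul_of_nonneg_left hy1 hb)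
      nlinarith [hτ s.length]
    have hv3 : RCLike.re ((u (m' :: s') - u s') v) =
        -(τ s.length * RCLike.re ((u (m' :: s') - u s') y)) := by
      rw [hv, map_neg, map_smul, smul_eq_mul, map_neg, RCLike.re_ofReal_mul]
    obtain ⟨t, t', ψ, h1, h2, h3, h4, h5, h6, h7⟩ := ih (n :: s) (m' :: s') (φ + v)
      (by rw [List.length_cons]; omega) (by simp [hs']) hn1 hm1
      ⟨hm3.1.le, fun x hx => (hn3.2 x hx).le, hI⟩
    refine ⟨t, t', ψ, h1, h2, h3, h4, h5, ?_, ?_⟩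
    · have h8 := hY v hvY.1 hMv
      rw [Finset.sum_eq_sum_Ico_succ_bot hsk]
      rw [List.length_cons] at h6
      linarith
    · rw [Finset.sum_eq_sum_Ico_succ_bot hsk]
      rw [List.length_cons] at h7
      have e : (u (n :: s) - u (m' :: s')) (φ + v) = (u s - u s') φ + (u s - u s') v +
          (u (n :: s) - u s) φ + (u (n :: s) - u s) v - (u (m' :: s') - u s') φ -
            (u (m' :: s') - u s') v := by
        simp only [_root_.sub_apply, map_add]
        ring
      rw [e, hv1, hv2, add_zero, add_zero, map_sub, map_sub, map_add, hv3] at h7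
      have h9 := (abs_le.1 hn2).1
      have h10 := (abs_le.1 hm2).2
      have h11 := (abs_le.1 (hr m' s' hm1 hs'k)).1
      rw [hs'] at h11
      have h12 : τ s.length * (r s.length / 4 - 2 * δ) ≤
          τ s.length * RCLike.re ((u (m' :: s') - u s') y) :=
        mul_le_mul_of_nonneg_left (by linarith) (hτ _)
      linarith

/-- If a tree changes by at most `L` between interlaced full nodes, then the limits `r i` of the
norms of its increments satisfy a bound in `ℓ_p` that does not depend on the height of the tree. -/
theorem exists_forall_sum_rpow_le {M : Seminorm 𝕜 W} (hM : IsEquivalentNorm M) {p q : ℝ}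
    (hpq : p.HolderConjugate q) (hMq : IsPAUS q M) {L : ℝ} (hL : 0 ≤ L) :
    ∃ A : ℝ, ∀ (U : Ultrafilter ℕ), (U : Filter ℕ) ≤ atTop → ∀ (k : ℕ)
      (u : List ℕ → StrongDual 𝕜 W),
      (∀ s, s.length < k → ∀ φ, Tendsto (fun n => u (n :: s) φ) U (𝓝 (u s φ))) →
      ∀ (F : Type*) [NormedAddCommGroup F] [NormedSpace 𝕜 F] (π : StrongDual 𝕜 W →L[𝕜] F)
        (r : ℕ → ℝ) (α : ℕ → F), (∀ i, 0 ≤ r i) →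
      (∀ δ > 0, ∃ G, IsRegularSubtree U k u π r α δ G ∧ ∀ t t', t.length = k → t'.length = k →
        G t → G t' → NodesInterlaced t t' → ‖u t - u t'‖ ≤ L) →
      ∑ i ∈ Finset.range k, r i ^ p ≤ A := by
  have hq1 : 1 < q := hpq.symm.lt
  have hp0 : 0 < p := hpq.pos
  have hq0 : 0 < q := hpq.symm.pos
  obtain ⟨C, hC0, hC⟩ := hMq.exists_submodule_rpow_le hq1
  obtain ⟨a, b, ha, hb, hab⟩ := hM
  -- The functional of `exists_interlaced_functional` with weights `r i ^ (p - 1)` has norm at most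
  -- a multiple of `S ^ (1 / q)`, where `S = ∑ r i ^ p`, and it separates by `S / 4`.
  refine ⟨(4 * L / a * C ^ q⁻¹ * b) ^ p, fun U hU k u hu F _ _ π r α hr hG => ?_⟩
  set S := ∑ i ∈ Finset.range k, r i ^ p with hS
  have hS0 : 0 ≤ S := Finset.sum_nonneg fun i _ => Real.rpow_nonneg (hr i) p
  set τ : ℕ → ℝ := fun i => r i ^ (p - 1) with hτdef
  have hτ : ∀ i, 0 ≤ τ i := fun i => Real.rpow_nonneg (hr i) _
  set T := ∑ i ∈ Finset.range k, (2 * τ i + 2) with hT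
  have hT0 : 0 ≤ T := Finset.sum_nonneg fun i _ => by linarith [hτ i]
  have hmain : ∀ δ > 0, S / 4 - δ * T ≤ L / a * C ^ q⁻¹ * b * S ^ q⁻¹ := by
    intro δ hδ
    obtain ⟨G, hG, hGL⟩ := hG δ hδ
    obtain ⟨t, t', ψ, h1, h2, h3, h4, h5, h6, h7⟩ := exists_interlaced_functional hU hb.le
      (fun w => (hab w).2) hC hu hδ hG.cons hG.norm_sub hτ k [] [] 0 (by simp) rfl hG.nil hG.nil
      trivial
    simp only [List.length_nil, ← Finset.range_eq_Ico, sub_self, map_zero, zero_add] at h6 h7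
    rw [Real.zero_rpow hq0.ne', zero_add] at h6
    have e1 : ∀ i, C * (b * τ i) ^ q = C * b ^ q * r i ^ p := fun i => by
      rw [Real.mul_rpow hb.le (hτ i), hτdef]
      dsimp only
      rw [← Real.rpow_mul (hr i), hpq.sub_one_mul_conj]
      ring
    have e2 : ∀ i, τ i * (r i / 4 - 2 * δ) - 2 * δ = r i ^ p / 4 - δ * (2 * τ i + 2) := fun i => by
      have : τ i * r i = r i ^ p := by
        rw [hτdef]
        dsimp only
        rcases (hr i).eq_or_lt with h0 | h0
        · rw [← h0, Real.zero_rpow hp0.ne', mul_zero]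
        · rw [Real.rpow_sub_one h0.ne']
          field_simp
      linear_combination this / 4
    simp only [e1] at h6
    simp only [e2] at h7
    rw [← Finset.mul_sum, ← hS] at h6
    rw [Finset.sum_sub_distrib, ← Finset.sum_div, ← Finset.mul_sum, ← hS, ← hT] at h7
    have h8 : M ψ ≤ C ^ q⁻¹ * b * S ^ q⁻¹ := by
      have h9 := Real.rpow_le_rpow (Real.rpow_nonneg (apply_nonneg M ψ) q) h6 (inv_nonneg.2 hq0.le)
      rw [Real.rpow_rpow_inv (apply_nonneg M ψ) hq0.ne', Real.mul_rpow (by positivity) hS0,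
        Real.mul_rpow hC0.le (by positivity), Real.rpow_rpow_inv hb.le hq0.ne'] at h9
      exact h9
    have h10 : ‖ψ‖ ≤ M ψ / a := by
      rw [le_div_iff₀ ha, mul_comm]
      exact (hab ψ).1
    calc S / 4 - δ * T ≤ RCLike.re ((u t - u t') ψ) := h7
      _ ≤ ‖u t - u t'‖ * ‖ψ‖ := (RCLike.re_le_norm _).trans ((u t - u t').le_opNorm ψ)
      _ ≤ L * (C ^ q⁻¹ * b * S ^ q⁻¹ / a) := by
        gcongr
        · exact hGL t t' h1 h2 h3 h4 h5
        · exact h10.trans (by gcongr)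
      _ = L / a * C ^ q⁻¹ * b * S ^ q⁻¹ := by ring
  have hlim : S / 4 ≤ L / a * C ^ q⁻¹ * b * S ^ q⁻¹ := by
    refine le_of_forall_pos_le_add fun ε hε => ?_
    have h := hmain (ε / (T + 1)) (by positivity)
    have : ε / (T + 1) * T ≤ ε := by
      rw [div_mul_eq_mul_div, div_le_iff₀ (by positivity)]
      nlinarith
    linarith
  rcases hS0.eq_or_lt with h0 | hpos
  · rw [← h0]
    positivity
  have hsplit : S = S ^ p⁻¹ * S ^ q⁻¹ := by
    rw [← Real.rpow_add hpos, hpq.inv_add_inv_eq_one, Real.rpow_one]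
  have hSq : 0 < S ^ q⁻¹ := Real.rpow_pos_of_pos hpos _
  have h11 : S ^ p⁻¹ ≤ 4 * L / a * C ^ q⁻¹ * b := by
    refine le_of_mul_le_mul_right ?_ hSq
    rw [← hsplit]
    linarith [show 4 * L / a * C ^ q⁻¹ * b * S ^ q⁻¹ = 4 * (L / a * C ^ q⁻¹ * b * S ^ q⁻¹) by ring]
  have h12 := Real.rpow_le_rpow (Real.rpow_nonneg hS0 _) h11 hp0.le
  rwa [Real.rpow_inv_rpow hS0 hp0.ne'] at h12

end Lower

/-! ### Differences of increments in the bidual -/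

section Upper

open Filter Topology

variable {𝕜 : Type*} [RCLike 𝕜] {X : Type*} [NormedAddCommGroup X] [NormedSpace 𝕜 X]

/-- The upper estimate. Two nodes `s`, `s'` of a regular subtree extend to full nodes such that,
up to a small error, the differences of the increments above `s` and `s'` lie in `X` and have a sum
controlled by the smoothness of `X`. The differences are close to `X` because the increments are
nearly constant modulo `X`, and being weak* small they are close to any prescribed subspace of
finite codimension of `X`. -/
theorem exists_extensions_norm_sub_le {U : Ultrafilter ℕ}
    {N : Seminorm 𝕜 X} {p C b : ℝ} (hb : 0 ≤ b) (hNb : ∀ x, N x ≤ b * ‖x‖)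
    (hC : ∀ (x : X) (c : ℝ), 0 ≤ c → ∃ Y : Submodule 𝕜 X, IsClosed (Y : Set X) ∧
      FiniteDimensional 𝕜 (X ⧸ Y) ∧ ∀ y ∈ Y, N y ≤ c → N (x + y) ^ p ≤ N x ^ p + C * c ^ p)
    {k : ℕ} {u : List ℕ → StrongDual 𝕜 (StrongDual 𝕜 X)} {B : ℝ} (hB : ∀ s, ‖u s‖ ≤ B)
    (hu : ∀ s, s.length < k → ∀ φ, Tendsto (fun n => u (n :: s) φ) U (𝓝 (u s φ)))
    {F : Type*} [NormedAddCommGroup F] [NormedSpace 𝕜 F]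
    {π : StrongDual 𝕜 (StrongDual 𝕜 X) →L[𝕜] F}
    (hπ : ∀ d, ∀ ε > 0, ∃ x, ‖d - NormedSpace.inclusionInDoubleDual 𝕜 X x‖ ≤ ‖π d‖ + ε)
    {r : ℕ → ℝ} {α : ℕ → F} (hr : ∀ i, 0 ≤ r i) {δ : ℝ} (hδ : 0 < δ) {G : List ℕ → Prop}
    (hG : IsRegularSubtree U k u π r α δ G) (m : ℕ) :
    ∀ (s s' : List ℕ) (x : X), s.length + m = k → s'.length = s.length → G s → G s' →
      ∃ (t t' : List ℕ) (x' : X), t.length = k ∧ t'.length = k ∧ s <:+ t ∧ s' <:+ t' ∧ G t ∧ G t' ∧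
        N x' ^ p ≤ N x ^ p + ∑ i ∈ Finset.Ico s.length k, C * (b * (2 * r i + 14 * δ)) ^ p ∧
        ‖(u t - u t') - (u s - u s') - NormedSpace.inclusionInDoubleDual 𝕜 X (x' - x)‖ ≤
          m * (12 * δ) := by
  set J := NormedSpace.inclusionInDoubleDual 𝕜 X with hJ
  have hJn : ∀ v : X, ‖J v‖ = ‖v‖ := (NormedSpace.inclusionInDoubleDualLi 𝕜 (E := X)).norm_map
  induction m with
  | zero =>
    intro s s' x hs hs' hGs hGs'
    refine ⟨s, s', x, hs, hs'.trans hs, List.suffix_rfl, List.suffix_rfl, hGs, hGs', ?_, ?_⟩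
    · rw [show s.length = k from hs]
      simp
    · simp
  | succ m ih =>
    intro s s' x hs hs' hGs hGs'
    have hsk : s.length < k := by omega
    have hs'k : s'.length < k := by omega
    have hsmall : ∀ s : List ℕ, s.length < k → ∀ (Y : Submodule 𝕜 X) [IsClosed (Y : Set X)]
        [FiniteDimensional 𝕜 (X ⧸ Y)], ∀ᶠ n in (U : Filter ℕ), ∀ ψ : StrongDual 𝕜 (X ⧸ Y),
          ‖(u (n :: s) - u s) (ψ.comp Y.mkQL)‖ ≤ δ / 2 * ‖ψ‖ := by
      intro s hs Y _ _
      refine eventually_forall_dual_quotient_le (B := B + B)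
        (fun n => (norm_sub_le _ _).trans (add_le_add (hB _) (hB _))) (fun φ => ?_) Y (half_pos hδ)
      have := (hu s hs φ).sub_const (u s φ)
      rwa [sub_self] at this
    have hc : 0 ≤ b * (2 * r s.length + 14 * δ) :=
      mul_nonneg hb (by linarith [hr s.length])
    obtain ⟨Y, hYc, hYf, hY⟩ := hC x _ hc
    obtain ⟨n, hn1, hn2⟩ := ((hG.cons s hGs hsk).and (hsmall s hsk Y)).exists
    obtain ⟨m', hm1, hm2⟩ := ((hG.cons s' hGs' hs'k).and (hsmall s' hs'k Y)).exists
    set d := (u (n :: s) - u s) - (u (m' :: s') - u s') with hd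
    have hdn : ‖d‖ ≤ 2 * r s.length + 2 * δ := by
      have h1 := (abs_le.1 (hG.norm_sub n s hn1 hsk)).2
      have h2 := (abs_le.1 (hG.norm_sub m' s' hm1 hs'k)).2
      rw [hs'] at h2
      exact (norm_sub_le _ _).trans (by linarith)
    have hπd : ‖π d‖ ≤ 4 * δ := by
      have h1 := hG.quot _ hGs
      have h2 := hG.quot _ hGs'
      have h3 := hG.quot _ hn1
      have h4 := hG.quot _ hm1
      rw [List.length_cons] at h3 h4
      rw [hs'] at h2 h4
      have e : π d = ((π (u (n :: s)) - α (s.length + 1)) - (π (u s) - α s.length)) -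
          ((π (u (m' :: s')) - α (s.length + 1)) - (π (u s') - α s.length)) := by
        simp only [hd, map_sub]
        abel
      rw [e]
      refine (norm_sub_le _ _).trans ?_
      linarith [norm_sub_le (π (u (n :: s)) - α (s.length + 1)) (π (u s) - α s.length),
        norm_sub_le (π (u (m' :: s')) - α (s.length + 1)) (π (u s') - α s.length)]
    obtain ⟨x₁, hx₁⟩ := hπ d δ hδ
    obtain ⟨y, hyY, hdy⟩ := exists_mem_norm_sub_le Y (d := d) (x := x₁) (η := 5 * δ) hδ
      (by positivity) (hx₁.trans (by linarith)) (fun ψ => by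
        rw [hd, _root_.sub_apply]
        refine (norm_sub_le _ _).trans ?_
        linarith [hn2 ψ, hm2 ψ])
    rw [← hJ] at hdy
    have hyn : ‖y‖ ≤ 2 * r s.length + 14 * δ := by
      have h1 := norm_sub_norm_le (J y) d
      rw [norm_sub_rev (J y) d, hJn] at h1
      linarith
    obtain ⟨t, t', x', h1, h2, h3, h4, h5, h6, h7, h8⟩ := ih (n :: s) (m' :: s') (x + y)
      (by rw [List.length_cons]; omega) (by simp [hs']) hn1 hm1
    refine ⟨t, t', x', h1, h2, (List.suffix_cons n s).trans h3, (List.suffix_cons m' s').trans h4,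
      h5, h6, ?_, ?_⟩
    · have h9 := hY y hyY ((hNb y).trans (mul_le_mul_of_nonneg_left hyn hb))
      rw [Finset.sum_eq_sum_Ico_succ_bot hsk]
      rw [List.length_cons] at h7
      linarith
    · have e : (u t - u t') - (u s - u s') - J (x' - x) =
          ((u t - u t') - (u (n :: s) - u (m' :: s')) - J (x' - (x + y))) + (d - J y) := by
        simp only [hd, map_sub, map_add]
        abel
      rw [e]
      refine (norm_add_le _ _).trans ?_
      push_cast
      linarith

end Upper

/-! ### Choosing a block of small increments -/

section Block

open Filter Topology

variable {𝕜 : Type*} [RCLike 𝕜]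

/-- A node of a regular subtree extends by any number of entries, all larger than `T`. -/
theorem exists_append_of_isRegularSubtree {U : Ultrafilter ℕ} (hU : (U : Filter ℕ) ≤ atTop)
    {W : Type*} [NormedAddCommGroup W] [NormedSpace 𝕜 W]
    {k : ℕ} {u : List ℕ → StrongDual 𝕜 W}
    {F : Type*} [NormedAddCommGroup F] [NormedSpace 𝕜 F] {π : StrongDual 𝕜 W →L[𝕜] F}
    {r : ℕ → ℝ} {α : ℕ → F} {δ : ℝ} {G : List ℕ → Prop}
    (hG : IsRegularSubtree U k u π r α δ G) (T l : ℕ) (s : List ℕ) (hs : G s)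
    (hsl : s.length + l ≤ k) :
    ∃ a : List ℕ, a.length = l ∧ (∀ x ∈ a, T < x) ∧ G (a ++ s) ∧
      ‖u (a ++ s) - u s‖ ≤ ∑ i ∈ Finset.range l, (r (s.length + i) + δ) := by
  induction l with
  | zero => exact ⟨[], rfl, by simp, hs, by simp⟩
  | succ l ih =>
    obtain ⟨a, h1, h2, h3, h4⟩ := ih (by omega)
    have hl : (a ++ s).length = s.length + l := by rw [List.length_append]; omega
    obtain ⟨n, hn1, hn2, -⟩ := ((hG.cons _ h3 (by omega)).and
      (eventually_forall_mem_lt hU [] T)).exists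
    refine ⟨n :: a, by simp [h1], ?_, hn1, ?_⟩
    · intro x hx
      rcases List.mem_cons.1 hx with rfl | hx
      · exact hn2
      · exact h2 x hx
    · have h5 := (abs_le.1 (hG.norm_sub n _ hn1 (by omega))).2
      rw [hl] at h5
      rw [Finset.sum_range_succ, List.cons_append]
      have e : u (n :: (a ++ s)) - u s = (u (a ++ s) - u s) + (u (n :: (a ++ s)) - u (a ++ s)) := by
        abel
      rw [e]
      refine (norm_add_le _ _).trans ?_
      linarith

/-- A nonnegative sequence of length `l * K` whose `p`-th powers have a sum smaller than
`K / l ^ p` contains a block of length `l` with all entries at most `1 / l`. -/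
theorem exists_block_le {p : ℝ} (hp : 0 < p) {l K : ℕ} (hl : 0 < l) {r : ℕ → ℝ} (hr : ∀ i, 0 ≤ r i)
    (h : (∑ i ∈ Finset.range (l * K), r i ^ p) < K * (1 / (l : ℝ)) ^ p) :
    ∃ c < K, ∀ i < l, r (l * c + i) ≤ 1 / l := by
  by_contra! hcon
  choose! e he1 he2 using hcon
  have hinj : Set.InjOn (fun c => l * c + e c) (Finset.range K) := by
    intro c hc c' hc' hcc
    have h1 := he1 c (Finset.mem_range.1 hc)
    have h2 := he1 c' (Finset.mem_range.1 hc')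
    have h3 : (l * c + e c) / l = (l * c' + e c') / l := congrArg (· / l) hcc
    rwa [Nat.mul_add_div hl, Nat.mul_add_div hl, Nat.div_eq_of_lt h1, Nat.div_eq_of_lt h2] at h3
  have hsub : (Finset.range K).image (fun c => l * c + e c) ⊆ Finset.range (l * K) := by
    intro j hj
    obtain ⟨c, hc, rfl⟩ := Finset.mem_image.1 hj
    have h1 := he1 c (Finset.mem_range.1 hc)
    have h2 : l * (c + 1) ≤ l * K := Nat.mul_le_mul_left l (Finset.mem_range.1 hc)
    rw [Finset.mem_range]
    linarith
  have h4 := Finset.sum_le_sum_of_subset_of_nonneg (f := fun i => r i ^ p) hsub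
    fun i _ _ => Real.rpow_nonneg (hr i) p
  rw [Finset.sum_image hinj] at h4
  have h5 : ∑ _c ∈ Finset.range K, (1 / (l : ℝ)) ^ p ≤
      ∑ c ∈ Finset.range K, r (l * c + e c) ^ p := by
    refine Finset.sum_le_sum fun c hc => ?_
    exact Real.rpow_le_rpow (by positivity) (he2 c (Finset.mem_range.1 hc)).le hp.le
  rw [Finset.sum_const, Finset.card_range, nsmul_eq_mul] at h5
  linarith

end Block

/-! ### Vertices of the interlaced graph -/

namespace KaltonVertex

/-- The entries of a vertex, in increasing order. -/
def entry {k : ℕ} (n : KaltonVertex k) : Fin k → ℕ := DFunLike.coe (F := Fin k ↪o ℕ) n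

theorem entry_monotone {k : ℕ} (n : KaltonVertex k) : Monotone n.entry :=
  OrderEmbedding.monotone (α := Fin k) (β := ℕ) n

theorem dist_le_one_of_interlaced {k : ℕ} {n m : KaltonVertex k} (h : Interlaced n m) :
    dist n m ≤ 1 := by
  by_cases hnm : n = m
  · rw [hnm, dist_self]
    exact zero_le_one
  · have hadj : (graph k).Adj n m := ⟨hnm, Or.inl h⟩
    have := SimpleGraph.dist_eq_one_iff_adj.2 hadj
    change (((graph k).dist n m : ℕ) : ℝ) ≤ 1
    rw [this, Nat.cast_one]

theorem apply_le_of_walk {k : ℕ} {n m : KaltonVertex k} (w : (graph k).Walk n m) :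
    ∀ i j : Fin k, (i : ℕ) + w.length = j → m.entry i ≤ n.entry j := by
  induction w with
  | nil =>
    intro i j h
    rw [SimpleGraph.Walk.length_nil, add_zero] at h
    rw [Fin.ext h]
  | @cons n v m hadj w ih =>
    intro i j h
    rw [SimpleGraph.Walk.length_cons] at h
    have hj := j.isLt
    refine (ih i ⟨i + w.length, by omega⟩ rfl).trans ?_
    rcases hadj.2 with h' | h'
    · exact h'.2 _ _ (by simp only; omega)
    · refine (h'.1 _).trans (n.entry_monotone ?_)
      rw [Fin.le_def]
      simp only
      omega

/-- A path in the interlaced graph of length less than `l` cannot move the `j`-th entry beyond the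
`(j + l - 1)`-st one. -/
theorem le_dist_of_lt {k l : ℕ} {n m : KaltonVertex k} {i j : Fin k} (hij : (i : ℕ) + 1 = j + l)
    (h : n.entry i < m.entry j) : (l : ℝ) ≤ dist n m := by
  obtain ⟨w, hw⟩ := (graph_connected k).exists_walk_length_eq_dist n m
  change (l : ℝ) ≤ (((graph k).dist n m : ℕ) : ℝ)
  rw [← hw, Nat.cast_le]
  by_contra! hlt
  have hi := i.isLt
  have h1 := apply_le_of_walk w j ⟨j + w.length, by omega⟩ rfl
  have h2 : n.entry ⟨j + w.length, by omega⟩ ≤ n.entry i := by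
    refine n.entry_monotone ?_
    rw [Fin.le_def]
    simp only
    omega
  omega

/-- A map that changes by at most `L` between interlaced vertices changes by at most `k * L` between
`{0, …, k - 1}` and any set of larger numbers. -/
theorem norm_sub_window_le {k : ℕ} {E : Type*} [NormedAddCommGroup E] {f : KaltonVertex k → E}
    {L : ℝ} (hf : ∀ n m, Interlaced n m → ‖f n - f m‖ ≤ L) (v : Fin k ↪o ℕ) (hv : ∀ i, k ≤ v i) :
    ‖f v - f (window k id strictMono_id 0)‖ ≤ k * L := by
  have ha : StrictMono (fun i : ℕ => if i < k then i else
      if h : i - k < k then v ⟨i - k, h⟩ else (∑ j, v j) + i) := by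
    have hsum : ∀ i, v i ≤ ∑ j, v j := fun i =>
      Finset.single_le_sum (f := fun i => v i) (fun _ _ => Nat.zero_le _) (Finset.mem_univ i)
    intro i j hij
    dsimp only
    split_ifs with h1 h2 h3 h4 h5 h6 h7 h8
    · exact hij
    · have := hv ⟨j - k, h3⟩
      omega
    · omega
    · omega
    · exact v.strictMono (by rw [Fin.lt_def]; simp only; omega)
    · have := hsum ⟨i - k, h4⟩
      omega
    · omega
    · omega
    · omega
  have hstep : ∀ j : ℕ, ‖f (window k _ ha j) - f (window k _ ha 0)‖ ≤ j * L := by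
    intro j
    induction j with
    | zero => simp
    | succ j ih =>
      have h1 : Interlaced (window k _ ha j) (window k _ ha (j + 1)) :=
        ⟨fun i => ha.monotone (show (i : ℕ) + j ≤ i + (j + 1) by omega), fun i i' h =>
          ha.monotone (show (i : ℕ) + (j + 1) ≤ i' + j by omega)⟩
      have h2 := hf _ _ h1
      rw [norm_sub_rev] at h2
      have h3 := norm_sub_le_norm_sub_add_norm_sub (f (window k _ ha (j + 1)))
        (f (window k _ ha j)) (f (window k _ ha 0))
      push_cast
      linarith
  have h0 : window k _ ha 0 = window k id strictMono_id 0 := by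
    refine DFunLike.ext (F := Fin k ↪o ℕ) _ _ fun i => ?_
    simp [window]
  have hk : window k _ ha k = v := by
    refine DFunLike.ext (F := Fin k ↪o ℕ) _ _ fun i => ?_
    simp [window]
  have := hstep k
  rwa [h0, hk] at this

/-- The vertex with the entries of a decreasing list. -/
def ofNode (k : ℕ) (t : List ℕ) (hk : t.length = k) (ht : t.Pairwise (· > ·)) : KaltonVertex k :=
  OrderEmbedding.ofStrictMono (fun i : Fin k => t[k - 1 - i]'(by have := i.isLt; omega))
    (fun i j hij => by
      have hj := j.isLt
      exact List.pairwise_iff_getElem.1 ht (k - 1 - j) (k - 1 - i) (by omega) (by omega)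
        (by rw [Fin.lt_def] at hij; omega))

theorem ofNode_apply {k : ℕ} {t : List ℕ} (hk : t.length = k) (ht : t.Pairwise (· > ·))
    (i : Fin k) : (ofNode k t hk ht).entry i =
      t[k - 1 - i]'(by have := i.isLt; omega) := rfl

end KaltonVertex

theorem NodesInterlaced.getElem {s s' : List ℕ} (h : NodesInterlaced s s') :
    (∀ (i : ℕ) (hi : i < s.length) (hi' : i < s'.length), s[i] ≤ s'[i]) ∧
      ∀ (i : ℕ) (hi : i < s.length) (hi' : i + 1 < s'.length), s'[i + 1] ≤ s[i] := by
  induction s generalizing s' with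
  | nil => simp
  | cons n s ih =>
    cases s' with
    | nil => simp
    | cons m s' =>
      obtain ⟨h1, h2, h3⟩ := h
      obtain ⟨h4, h5⟩ := ih h3
      refine ⟨fun i hi hi' => ?_, fun i hi hi' => ?_⟩
      · cases i with
        | zero => exact h1
        | succ i => exact h4 i (by simpa using hi) (by simpa using hi')
      · cases i with
        | zero => exact h2 _ (List.getElem_mem _)
        | succ i => exact h5 i (by simpa using hi) (by simpa using hi')

theorem NodesInterlaced.interlaced_ofNode {k : ℕ} {t t' : List ℕ} (h : NodesInterlaced t t')
    (hk : t.length = k) (ht : t.Pairwise (· > ·)) (hk' : t'.length = k)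
    (ht' : t'.Pairwise (· > ·)) :
    KaltonVertex.Interlaced (KaltonVertex.ofNode k t hk ht) (KaltonVertex.ofNode k t' hk' ht') := by
  refine ⟨fun i => ?_, fun i j hij => ?_⟩
  · have := i.isLt
    exact h.getElem.1 (k - 1 - i) (by omega) (by omega)
  · have := j.isLt
    have h1 := h.getElem.2 (k - 1 - j) (by omega) (by omega)
    have e : k - 1 - (i : ℕ) = k - 1 - j + 1 := by omega
    change (KaltonVertex.ofNode k t' hk' ht').entry i ≤ (KaltonVertex.ofNode k t hk ht).entry j
    rw [KaltonVertex.ofNode_apply, KaltonVertex.ofNode_apply]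
    simpa only [e] using h1

/-! ### Distant vertices with close images -/

section Main

open Filter Topology

universe v w

variable {𝕜 : Type v} [RCLike 𝕜] {X : Type w} [NormedAddCommGroup X] [NormedSpace 𝕜 X]

theorem sum_rpow_two_mul_add_le {p : ℝ} (hp : 1 < p) {k : ℕ} {r : ℕ → ℝ} (hr : ∀ i, 0 ≤ r i)
    (j : ℕ) : ∑ i ∈ Finset.Ico j k, (2 * r i + 14 * (1 / (28 * ((k : ℝ) + 1)))) ^ p ≤
      4 ^ p * ∑ i ∈ Finset.range k, r i ^ p + 1 := by
  have hp0 : 0 < p := by linarith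
  set s : ℝ := 1 / ((k : ℝ) + 1) with hs
  have hs0 : 0 < s := by positivity
  have hs1 : s ≤ 1 := by
    rw [hs, div_le_one (by positivity)]
    linarith [k.cast_nonneg (α := ℝ)]
  have e : 14 * (1 / (28 * ((k : ℝ) + 1))) = s / 2 := by
    rw [hs]
    field_simp
    norm_num
  have hterm : ∀ i, (2 * r i + s / 2) ^ p ≤ 4 ^ p * r i ^ p + s := by
    intro i
    have hri := hr i
    rcases le_total (2 * r i) (s / 2) with h | h
    · calc (2 * r i + s / 2) ^ p ≤ s ^ p := Real.rpow_le_rpow (by positivity) (by linarith) hp0.le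
        _ ≤ s ^ (1 : ℝ) := Real.rpow_le_rpow_of_exponent_ge hs0 hs1 hp.le
        _ = s := Real.rpow_one s
        _ ≤ _ := by linarith [show 0 ≤ (4 : ℝ) ^ p * r i ^ p by positivity]
    · calc (2 * r i + s / 2) ^ p ≤ (4 * r i) ^ p :=
            Real.rpow_le_rpow (by positivity) (by linarith) hp0.le
        _ = 4 ^ p * r i ^ p := Real.mul_rpow (by norm_num) hri
        _ ≤ _ := by linarith
  rw [e]
  calc ∑ i ∈ Finset.Ico j k, (2 * r i + s / 2) ^ p
      ≤ ∑ i ∈ Finset.range k, (2 * r i + s / 2) ^ p := by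
        refine Finset.sum_le_sum_of_subset_of_nonneg (fun i hi => ?_) fun i _ _ => ?_
        · exact Finset.mem_range.2 (Finset.mem_Ico.1 hi).2
        · have := hr i
          positivity
    _ ≤ ∑ i ∈ Finset.range k, (4 ^ p * r i ^ p + s) := Finset.sum_le_sum fun i _ => hterm i
    _ = 4 ^ p * ∑ i ∈ Finset.range k, r i ^ p + k * s := by
        rw [Finset.sum_add_distrib, ← Finset.mul_sum, Finset.sum_const, Finset.card_range,
          nsmul_eq_mul]
    _ ≤ _ := by
        have : (k : ℝ) * s ≤ 1 := by
          rw [hs, mul_one_div, div_le_one (by positivity)]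
          linarith
        linarith

/-- A quasi-reflexive space has a finite-dimensional normed quotient of its bidual whose norm
controls the distance to the space. -/
theorem IsQuasiReflexive.exists_quotient [CompleteSpace X] (hX : IsQuasiReflexive 𝕜 X) :
    ∃ (F : Type (max v w)) (_ : NormedAddCommGroup F) (_ : NormedSpace 𝕜 F) (_ : FiniteDimensional 𝕜 F)
      (π : StrongDual 𝕜 (StrongDual 𝕜 X) →L[𝕜] F),
      ∀ d, ∀ ε > 0, ∃ x, ‖d - NormedSpace.inclusionInDoubleDual 𝕜 X x‖ ≤ ‖π d‖ + ε := by
  set R := LinearMap.range (NormedSpace.inclusionInDoubleDual 𝕜 X).toLinearMap with hR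
  have hclosed : IsClosed (R : Set (StrongDual 𝕜 (StrongDual 𝕜 X))) := by
    rw [hR, LinearMap.coe_range]
    exact (NormedSpace.inclusionInDoubleDualLi 𝕜 (E := X)).isometry.isClosedEmbedding.isClosed_range
  refine ⟨StrongDual 𝕜 (StrongDual 𝕜 X) ⧸ R, inferInstance, inferInstance, hX, R.mkQL,
    fun d ε hε => ?_⟩
  obtain ⟨e, he, hen⟩ := Submodule.Quotient.norm_mk_lt (R.mkQL d) hε
  obtain ⟨x, hx⟩ := (Submodule.Quotient.eq R).1 he.symm
  refine ⟨x, ?_⟩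
  have hx' : NormedSpace.inclusionInDoubleDual 𝕜 X x = d - e := hx
  rw [hx', sub_sub_cancel]
  exact hen.le

/-- Maps from the interlaced graphs to the bidual that change by at most `L` between interlaced
vertices send some vertices at distance at least `l` to points at distance at most `D`, where `D`
does not depend on `l`. -/
theorem exists_dist_ge_norm_sub_le [CompleteSpace X] (hX : IsQuasiReflexive 𝕜 X) {p q : ℝ}
    (hpq : p.HolderConjugate q) (hXp : AdmitsEquivalentPAUSNorm 𝕜 X p)
    (hXq : AdmitsEquivalentPAUSNorm 𝕜 (StrongDual 𝕜 X) q) {L : ℝ} (hL : 0 ≤ L) :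
    ∃ D : ℝ, ∀ l : ℕ, 0 < l → ∃ k : ℕ, 0 < k ∧
      ∀ f : KaltonVertex k → StrongDual 𝕜 (StrongDual 𝕜 X),
        (∀ n m, KaltonVertex.Interlaced n m → ‖f n - f m‖ ≤ L) →
        ∃ n m, (l : ℝ) ≤ dist n m ∧ ‖f n - f m‖ ≤ D := by
  have hp : 1 < p := hpq.lt
  have hp0 : 0 < p := hpq.pos
  obtain ⟨F, _, _, _, π, hπ⟩ := hX.exists_quotient
  obtain ⟨M, hM, hMq⟩ := hXq
  obtain ⟨A, hA⟩ := exists_forall_sum_rpow_le hM hpq hMq hL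
  obtain ⟨N, ⟨a, b, ha, hb, hab⟩, hNp⟩ := hXp
  obtain ⟨C, hC0, hC⟩ := hNp.exists_submodule_rpow_le hp
  set S := C * (b ^ p * (4 ^ p * A + 1)) with hS
  refine ⟨S ^ p⁻¹ / a + 5, fun l hl => ?_⟩
  have hl0 : (0 : ℝ) < l := Nat.cast_pos.2 hl
  have hlp : 0 < (1 / (l : ℝ)) ^ p := by positivity
  obtain ⟨K, hK⟩ := exists_nat_gt (max 0 (A / (1 / (l : ℝ)) ^ p))
  have hK0 : 0 < K := by
    have := (le_max_left _ _).trans_lt hK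
    exact_mod_cast this
  have hKA : A < K * (1 / (l : ℝ)) ^ p := (div_lt_iff₀ hlp).1 ((le_max_right _ _).trans_lt hK)
  obtain ⟨k, hk⟩ : ∃ k, k = l * K := ⟨_, rfl⟩
  refine ⟨k, hk ▸ Nat.mul_pos hl hK0, fun f hf => ?_⟩
  set U : Ultrafilter ℕ := hyperfilter ℕ
  have hU : (U : Filter ℕ) ≤ atTop := Nat.hyperfilter_le_atTop
  classical
  let g : List ℕ → StrongDual 𝕜 (StrongDual 𝕜 X) := fun t =>
    if h : t.length = k ∧ t.Pairwise (· > ·) ∧ ∀ x ∈ t, k ≤ x then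
      f (KaltonVertex.ofNode k t h.1 h.2.1) else 0
  have hg : ∀ t, ‖g t‖ ≤ ‖f (KaltonVertex.window k id strictMono_id 0)‖ + k * L := by
    intro t
    by_cases h : t.length = k ∧ t.Pairwise (· > ·) ∧ ∀ x ∈ t, k ≤ x
    · simp only [g, dif_pos h]
      have h1 := KaltonVertex.norm_sub_window_le hf (KaltonVertex.ofNode k t h.1 h.2.1)
        fun i => h.2.2 _ (List.getElem_mem _)
      have h2 := norm_le_norm_add_norm_sub'
        (f (KaltonVertex.ofNode k t h.1 h.2.1)) (f (KaltonVertex.window k id strictMono_id 0))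
      linarith
    · simp only [g, dif_neg h, norm_zero]
      positivity
  obtain ⟨u, huB, hug, hu⟩ := exists_weakStar_tree U k g hg
  obtain ⟨r, α, hr, hreg⟩ := exists_isRegularSubtree (𝕜 := 𝕜) hU k u huB π
  have huf : ∀ (t : List ℕ) (h1 : t.length = k) (h2 : t.Pairwise (· > ·) ∧ ∀ x ∈ t, k ≤ x),
      u t = f (KaltonVertex.ofNode k t h1 h2.1) := by
    intro t h1 h2
    rw [hug t h1]
    exact dif_pos ⟨h1, h2⟩
  have hrA : ∑ i ∈ Finset.range k, r i ^ p ≤ A := by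
    refine hA U hU k u hu F π r α hr fun δ hδ => ?_
    obtain ⟨G, hG⟩ := hreg δ hδ
    refine ⟨G, hG, fun t t' h1 h2 h3 h4 h5 => ?_⟩
    rw [huf t h1 (hG.pairwise t h3 h1), huf t' h2 (hG.pairwise t' h4 h2)]
    exact hf _ _ (h5.interlaced_ofNode _ _ _ _)
  -- The vertices agree up to the block with small increments; the second one jumps there.
  obtain ⟨c, hcK, hc⟩ := exists_block_le hp0 hl hr ((hk ▸ hrA).trans_lt hKA)
  have hck : l * c + l ≤ k := by
    have : l * (c + 1) ≤ l * K := Nat.mul_le_mul_left l hcK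
    linarith
  -- With this `δ` the errors of all `k` levels, `12 * δ` each, add up to at most `1`, and the terms
  -- `(14 * δ) ^ p` in the upper estimate contribute a bounded amount.
  set δ : ℝ := 1 / (28 * ((k : ℝ) + 1)) with hδ
  have hδ0 : 0 < δ := by positivity
  have hkδ : k * δ ≤ 1 / 28 := by
    rw [hδ, mul_one_div, div_le_iff₀ (by positivity)]
    linarith
  obtain ⟨G, hG⟩ := hreg δ hδ0
  obtain ⟨s, hs, -, hGs, -⟩ := exists_append_of_isRegularSubtree hU hG 0 (l * c) [] hG.nil
    (by simp only [List.length_nil]; omega)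
  rw [List.append_nil] at hGs
  obtain ⟨a₁, ha₁, -, hGa₁, hua₁⟩ := exists_append_of_isRegularSubtree hU hG 0 l s hGs (by omega)
  obtain ⟨a₂, ha₂, hTa₂, hGa₂, hua₂⟩ :=
    exists_append_of_isRegularSubtree hU hG (a₁ ++ s).sum l s hGs (by omega)
  have hblock : ∑ i ∈ Finset.range l, (r (s.length + i) + δ) ≤ 2 := by
    have h1 : ∑ i ∈ Finset.range l, (r (s.length + i) + δ) ≤
        ∑ _i ∈ Finset.range l, (1 / (l : ℝ) + δ) := by
      refine Finset.sum_le_sum fun i hi => ?_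
      rw [hs]
      linarith [hc i (Finset.mem_range.1 hi)]
    rw [Finset.sum_const, Finset.card_range, nsmul_eq_mul, mul_add, mul_one_div_cancel hl0.ne'] at h1
    have h2 : (l : ℝ) * δ ≤ k * δ := by
      gcongr
      omega
    linarith
  have hlen₁ : (a₁ ++ s).length = l * c + l := by rw [List.length_append]; omega
  have hlen₂ : (a₂ ++ s).length = l * c + l := by rw [List.length_append]; omega
  obtain ⟨t, t', x, ht, ht', hst, hst', hGt, hGt', hNx, hux⟩ :=
    exists_extensions_norm_sub_le hb.le (fun x => (hab x).2) hC huB hu hπ hr hδ0 hG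
      (k - (l * c + l)) (a₁ ++ s) (a₂ ++ s) 0 (by omega) (by omega) hGa₁ hGa₂
  have hpt := hG.pairwise t hGt ht
  have hpt' := hG.pairwise t' hGt' ht'
  refine ⟨KaltonVertex.ofNode k t ht hpt.1, KaltonVertex.ofNode k t' ht' hpt'.1, ?_, ?_⟩
  · refine KaltonVertex.le_dist_of_lt (i := ⟨l * c + l - 1, by omega⟩) (j := ⟨l * c, by omega⟩)
      (by simp only; omega) ?_
    obtain ⟨t₀, rfl⟩ := hst
    obtain ⟨t₀', rfl⟩ := hst'
    rw [List.length_append] at ht ht'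
    rw [KaltonVertex.ofNode_apply, KaltonVertex.ofNode_apply]
    refine lt_of_le_of_lt (b := (a₁ ++ s).sum) ?_ ?_
    · rw [List.getElem_append_right (by simp only; omega)]
      exact List.le_sum_of_mem (List.getElem_mem _)
    · rw [List.getElem_append_right (by simp only; omega),
        List.getElem_append_left (by simp only; omega)]
      exact hTa₂ _ (List.getElem_mem _)
  · rw [← huf t ht hpt, ← huf t' ht' hpt']
    have hx : ‖x‖ ≤ S ^ p⁻¹ / a := by
      have h1 : N x ^ p ≤ S := by
        rw [map_zero, Real.zero_rpow hp0.ne', zero_add, ← Finset.mul_sum] at hNx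
        refine hNx.trans ?_
        rw [hS]
        refine mul_le_mul_of_nonneg_left ?_ hC0.le
        have h2 : ∀ i, (b * (2 * r i + 14 * δ)) ^ p = b ^ p * (2 * r i + 14 * δ) ^ p := fun i =>
          Real.mul_rpow hb.le (by linarith [hr i])
        simp only [h2]
        rw [← Finset.mul_sum]
        refine mul_le_mul_of_nonneg_left ?_ (by positivity)
        refine (sum_rpow_two_mul_add_le hp hr _).trans ?_
        gcongr
      have h3 := Real.rpow_le_rpow (Real.rpow_nonneg (apply_nonneg N x) p) h1 (inv_nonneg.2 hp0.le)
      rw [Real.rpow_rpow_inv (apply_nonneg N x) hp0.ne'] at h3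
      rw [le_div_iff₀ ha, mul_comm]
      exact ((hab x).1).trans h3
    set J := NormedSpace.inclusionInDoubleDual 𝕜 X with hJ
    have hJx : ‖J (x - 0)‖ = ‖x‖ := by
      rw [sub_zero]
      exact (NormedSpace.inclusionInDoubleDualLi 𝕜 (E := X)).norm_map x
    have herr : ((k - (l * c + l) : ℕ) : ℝ) * (12 * δ) ≤ 1 := by
      have h1 : ((k - (l * c + l) : ℕ) : ℝ) * (12 * δ) ≤ k * (12 * δ) := by
        gcongr
        omega
      linarith
    have e : u t - u t' = ((u t - u t') - (u (a₁ ++ s) - u (a₂ ++ s)) - J (x - 0)) + J (x - 0) +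
        ((u (a₁ ++ s) - u s) - (u (a₂ ++ s) - u s)) := by
      abel
    rw [e]
    refine (norm_add₃_le).trans ?_
    have h5 := norm_sub_le (u (a₁ ++ s) - u s) (u (a₂ ++ s) - u s)
    rw [hJx]
    linarith

end Main

theorem theorem4p1 {𝕜 : Type*} [RCLike 𝕜]
    {X : Type*} [NormedAddCommGroup X] [NormedSpace 𝕜 X] [CompleteSpace X]
    (hX : IsQuasiReflexive 𝕜 X)
    (p q : ℝ) (hp : 1 < p) (hpq : p.HolderConjugate q)
    (hXp : AdmitsEquivalentPAUSNorm 𝕜 X p)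
    (hXq : AdmitsEquivalentPAUSNorm 𝕜 (StrongDual 𝕜 X) q) :
    ¬ EquiCoarselyEmbeds (fun k : ℕ+ => KaltonVertex (k : ℕ))
        (StrongDual 𝕜 (StrongDual 𝕜 X)) := by
  rintro ⟨ρ, ω, f, hρ, hf⟩
  obtain ⟨D, hD⟩ := exists_dist_ge_norm_sub_le hX hpq hXp hXq (ω 1).coe_nonneg
  obtain ⟨l, hρl, hl⟩ := (((hρ.comp tendsto_natCast_atTop_atTop).eventually
    (Filter.eventually_gt_atTop D.toNNReal)).and (Filter.eventually_gt_atTop 0)).exists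
  obtain ⟨k, hk, hfk⟩ := hD l hl
  obtain ⟨n, m, hnm, hfnm⟩ := hfk (f ⟨k, hk⟩) fun n m h => by
    have h1 : edist (f ⟨k, hk⟩ n) (f ⟨k, hk⟩ m) ≤ ω 1 := by
      refine le_trans ?_ (hf ⟨k, hk⟩ 1).2
      refine le_iSup_of_le n (le_iSup_of_le m (le_iSup_of_le ?_ le_rfl))
      exact KaltonVertex.dist_le_one_of_interlaced h
    rw [edist_nndist, ENNReal.coe_le_coe] at h1
    rw [← dist_eq_norm]
    exact_mod_cast h1
  have h2 : (ρ l : ℝ≥0∞) ≤ edist (f ⟨k, hk⟩ n) (f ⟨k, hk⟩ m) := by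
    refine (hf ⟨k, hk⟩ l).1.trans ?_
    refine iInf_le_of_le n (iInf_le_of_le m (iInf_le_of_le ?_ le_rfl))
    rw [NNReal.coe_natCast]
    exact hnm
  rw [edist_nndist, ENNReal.coe_le_coe] at h2
  have h3 : nndist (f ⟨k, hk⟩ n) (f ⟨k, hk⟩ m) ≤ D.toNNReal := by
    rw [← NNReal.coe_le_coe, coe_nndist, dist_eq_norm]
    exact hfnm.trans (Real.le_coe_toNNReal D)
  exact absurd (h2.trans h3) (not_le.2 hρl)
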